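/- Let $d\in\mathbb N$, let $(\Omega,\mathcal F,\mathbb P)$ be a probability space, and let $H=H(p,x,\omega):\mathbb R^d\times\mathbb R^d\times\Omega\to\mathbb R$ be measurable in $\omega$ and satisfy the following. (A1) (Stationary ergodicity) There is a group $\{\tau_x\}_{x\in\mathbb R^d}$ of measurable, measure-preserving transformations of $\Omega$ with $\tau_{y+z}=\tau_y\circ\tau_z$ such that $H(p,y,\tau_z\omega)=H(p,y+z,\omega)$ for all $p,y,z,\omega$, and such that $\mathbb P[A]\in\{0,1\}$ for every $A\in\mathcal F$ with $\tau_z(A)=A$ for all $z$. (A2) (Coercivity) $\liminf_{|p|\to\infty}\operatorname{ess\,inf}_{(x,\omega)\in\mathbb R^d\times\Omega}|H(p,x,\omega)|=\infty$. (A3) (Continuity and boundedness) For every $\omega$ and every compact $K\subset\mathbb R^d$ there is a modulus of continuity $\rho$ with $|H(p,x,\omega)-H(q,y,\omega)|\le\rho(|p-q|+|x-y|)$ for all $p,q\in K$ and $x,y\in\mathbb R^d$; and $H$ is bounded on $K\times\mathbb R^d\times\Omega$ for every compact $K\subset\mathbb R^d$. Suppose that $H$ is regularly homogenizable at every $p\in\mathbb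 R^d$, with effective Hamiltonian $\overline H:\mathbb R^d\to\mathbb R$; that is, for every $p\in\mathbb R^d$, almost surely, the bounded continuous viscosity solutions $v_\lambda$, $\lambda>0$, of $$\lambda v_\lambda+H(p+Dv_\lambda,x,\omega)=0\quad\text{in }\mathbb R^d$$ satisfy $\lim_{\lambda\to0^+}\max_{|x|\le R/\lambda}|\lambda v_\lambda(x)+\overline H(p)|=0$ for every $R>0$. Let $u_0:\mathbb R^d\to\mathbb R$ be bounded and uniformly continuous. Solutions of the Cauchy problems below are understood as viscosity solutions that are continuous on $\mathbb R^d\times[0,\infty)$ and bounded on $\mathbb R^d\times[0,T]$ for every $T>0$. For $\varepsilon>0$ and almost every $\omega$ let $u^\varepsilon(\cdot,\cdot,\omega)$ be the viscosity solution of $$u^\varepsilon_t+H\!\left(Du^\varepsilon,\tfrac x\varepsilon,\omega\right)=0\ \text{ in }\mathbb R^d\times(0,\infty),\qquad u^\varepsilon(x,0,\omega)=u_0(x).$$ Then there are an event $\widetilde\Omega\in\mathcal F$ with $\mathbb P(\widetilde\Omega)=1$ and a deterministic function $\overline u:\mathbb R^d\times[0,\infty)\to\mathbb R$ such that, for every $\omega\in\widetilde\Omega$,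 $u^\varepsilon(\cdot,\cdot,\omega)\to\overline u$ locally uniformly in $\mathbb R^d\times(0,\infty)$ as $\varepsilon\to0^+$. Moreover, $\overline u$ is the unique viscosity solution of $$\overline u_t+\overline H(D\overline u)=0\ \text{ in }\mathbb R^d\times(0,\infty),\qquad \overline u(x,0)=u_0(x).$$ -/

import Mathlib

open Set Filter Topology MeasureTheory

/-- Euclidean space `ℝ^d`. -/
abbrev Rd (d : ℕ) : Type := EuclideanSpace ℝ (Fin d)

/-- Modulus of continuity: nondecreasing on `[0,∞)`, zero at `0`, and tending to `0` at `0+`. -/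
structure IsModulus (ρ : ℝ → ℝ) : Prop where
  mono : MonotoneOn ρ (Ici 0)
  zero : ρ 0 = 0
  tendsto : Tendsto ρ (𝓝[>] 0) (𝓝 0)

/-- Stationary ergodicity of the random field `H(p, x, ω)` with respect to some measure-preserving
group `τ` of transformations of `Ω` indexed by `ℝ^d`. -/
def IsStationaryErgodic {d : ℕ} {Ω : Type*} [MeasurableSpace Ω] (μ : Measure Ω)
    (H : Rd d → Rd d → Ω → ℝ) : Prop :=
  (∀ p x, Measurable (H p x)) ∧
  ∃ τ : Rd d → Ω → Ω,
    τ 0 = id ∧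
    (∀ y z, τ (y + z) = τ y ∘ τ z) ∧
    (∀ y, MeasurePreserving (τ y) μ μ) ∧
    (∀ p y z ω, H p y (τ z ω) = H p (y + z) ω) ∧
    (∀ A : Set Ω, MeasurableSet A → (∀ z, τ z '' A = A) → μ A = 0 ∨ μ A = 1)

/-- Coercivity: `liminf_{|p| → ∞} essinf_{(x,ω)} |H(p,x,ω)| = ∞`. -/
def IsCoerciveHamiltonian {d : ℕ} {Ω : Type*} [MeasurableSpace Ω] (μ : Measure Ω)
    (H : Rd d → Rd d → Ω → ℝ) : Prop :=
  liminf (fun p : Rd d =>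
    essInf (fun z : Rd d × Ω => ENNReal.ofReal |H p z.1 z.2|) ((volume : Measure (Rd d)).prod μ))
    (Bornology.cobounded (Rd d)) = ⊤

/-- For every `ω` and every compact `K`, a modulus of continuity for `H(·,·,ω)` on `K × ℝ^d`; and
for every compact `K`, boundedness of `H` on `K × ℝ^d × Ω`. -/
def IsContinuousBounded {d : ℕ} {Ω : Type*} (H : Rd d → Rd d → Ω → ℝ) : Prop :=
  (∀ ω, ∀ K : Set (Rd d), IsCompact K → ∃ ρ : ℝ → ℝ, IsModulus ρ ∧
    ∀ p ∈ K, ∀ q ∈ K, ∀ x y, |H p x ω - H q y ω| ≤ ρ (‖p - q‖ + ‖x - y‖)) ∧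
  (∀ K : Set (Rd d), IsCompact K → ∃ C : ℝ, ∀ p ∈ K, ∀ x ω, |H p x ω| ≤ C)

/-- `v` is a bounded continuous viscosity solution of `l v + H(p₀ + Dv, x) = 0` in `ℝ^d`. -/
structure IsAuxiliarySolution {d : ℕ} (H : Rd d → Rd d → ℝ) (l : ℝ) (p₀ : Rd d)
    (v : Rd d → ℝ) : Prop where
  continuous : Continuous v
  bounded : ∃ C : ℝ, ∀ x, |v x| ≤ C
  sub : ∀ (φ : Rd d → ℝ) (x : Rd d), ContDiff ℝ 1 φ → IsLocalMax (fun y => v y - φ y) x →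
    l * v x + H (p₀ + gradient φ x) x ≤ 0
  super : ∀ (φ : Rd d → ℝ) (x : Rd d), ContDiff ℝ 1 φ → IsLocalMin (fun y => v y - φ y) x →
    0 ≤ l * v x + H (p₀ + gradient φ x) x

/-- `H` is regularly homogenizable at `p₀`, with effective value `h`: almost surely the bounded
solutions `v_l`, `l > 0`, of the auxiliary problem satisfy `max_{|x| ≤ R/l} |l v_l(x) + h| → 0` as
`l → 0+`, for every `R > 0`. -/
def IsRegularlyHomogenizableAt {d : ℕ} {Ω : Type*} [MeasurableSpace Ω] (μ : Measure Ω)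
    (H : Rd d → Rd d → Ω → ℝ) (p₀ : Rd d) (h : ℝ) : Prop :=
  ∀ᵐ ω ∂μ, ∃ v : ℝ → Rd d → ℝ,
    (∀ l > 0, IsAuxiliarySolution (fun p x => H p x ω) l p₀ (v l)) ∧
    ∀ R > 0, ∀ δ > 0, ∀ᶠ l in 𝓝[>] (0 : ℝ), ∀ x, ‖x‖ ≤ R / l → |l * v l x + h| ≤ δ

/-- `u` is a viscosity solution of `u_t + H(Du, x) = 0` in `ℝ^d × (0,∞)` with `u(·,0) = u₀`, in the
class of continuous functions on `ℝ^d × [0,∞)` that are bounded on `ℝ^d × [0,T]` for each `T`.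
Only the values `u x t` with `t ≥ 0` matter. -/
structure IsCauchySolution {d : ℕ} (H : Rd d → Rd d → ℝ) (u₀ : Rd d → ℝ)
    (u : Rd d → ℝ → ℝ) : Prop where
  continuousOn : ContinuousOn (fun z : Rd d × ℝ => u z.1 z.2) (univ ×ˢ Ici 0)
  bounded : ∀ T : ℝ, ∃ C : ℝ, ∀ x, ∀ t ∈ Icc 0 T, |u x t| ≤ C
  initial : ∀ x, u x 0 = u₀ x
  sub : ∀ (φ : Rd d × ℝ → ℝ) (x : Rd d) (t : ℝ), 0 < t → ContDiff ℝ 1 φ →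
    IsLocalMax (fun z : Rd d × ℝ => u z.1 z.2 - φ z) (x, t) →
    deriv (fun s => φ (x, s)) t + H (gradient (fun y => φ (y, t)) x) x ≤ 0
  super : ∀ (φ : Rd d × ℝ → ℝ) (x : Rd d) (t : ℝ), 0 < t → ContDiff ℝ 1 φ →
    IsLocalMin (fun z : Rd d × ℝ => u z.1 z.2 - φ z) (x, t) →
    0 ≤ deriv (fun s => φ (x, s)) t + H (gradient (fun y => φ (y, t)) x) x

/-! The proof is Evans' perturbed test function method, run for one realization `ω` at a time and
combined with half-relaxed limits. The approximate correctors are the solutions `v_ε` of the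
auxiliary problem: near a point, `ε v_ε(x/ε)` is uniformly close to `-h`, where `h` is the effective
value.

The heart is `timeDeriv_add_le_of_frequently`. If `u^ε - φ` has a strict interior maximum for
arbitrarily small `ε`, the space variable is doubled against the corrector. The two viscosity
inequalities then compare `H` at slopes differing by the small vector `Dφ - q` and at nearby points,
and the effective inequality for `φ` follows. The penalization may add an uncontrolled vector `Q` to
both slopes. Since coercivity concerns only `|H|`, a large `Q` is excluded by a sign argument
(`not_sign_change`): far from the origin `H` cannot pass from very negative to very positive between
nearby slopes.

The same lemma, applied to the functions built from the correctors themselves, gives continuity of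
the effective Hamiltonian (`HomogenizesAt.exists_abs_sub_le`). Each slope has its own null set, so
only countably many slopes can be used for a fixed `ω`; continuity makes a dense sequence enough.

Barriers give estimates on `u^ε` near `t = 0` that are uniform in `ε`, hence bounds. The upper
relaxed limits `U` of `u^ε` and `W` of `-u^ε` therefore exist, and each satisfies a subsolution
property. Comparison (`add_le_zero_of_isViscositySubOn`) gives `U + W ≤ 0`, while `U + W ≥ 0` always
holds. So `W = -U`, which is at once continuity of the limit, the equation, and locally uniform
convergence. Uniqueness for the effective problem makes the limit independent of `ω`. -/

/-! ### Gradient calculus and a smooth, 1-Lipschitz distance-like function. -/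

section Gradient

variable {d : ℕ}

theorem HasGradientAt.add_gradient {f g : Rd d → ℝ} {a b x : Rd d} (hf : HasGradientAt f a x)
    (hg : HasGradientAt g b x) : HasGradientAt (fun y => f y + g y) (a + b) x := by
  rw [hasGradientAt_iff_hasFDerivAt, map_add]
  exact hf.hasFDerivAt.add hg.hasFDerivAt

theorem HasGradientAt.const_mul_gradient {f : Rd d → ℝ} {a x : Rd d} (c : ℝ)
    (hf : HasGradientAt f a x) : HasGradientAt (fun y => c * f y) (c • a) x := by
  rw [hasGradientAt_iff_hasFDerivAt, map_smul]
  exact hf.hasFDerivAt.const_mul c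

theorem HasGradientAt.neg_gradient {f : Rd d → ℝ} {a x : Rd d}
    (hf : HasGradientAt f a x) : HasGradientAt (fun y => - f y) (-a) x := by
  simpa using hf.const_mul_gradient (-1)

/-- Chain rule for the gradient along a homothety. -/
theorem HasGradientAt.comp_smul {f : Rd d → ℝ} {a : Rd d} (ε : ℝ) (x : Rd d)
    (hf : HasGradientAt f a (ε • x)) : HasGradientAt (fun y => f (ε • y)) (ε • a) x := by
  rw [hasGradientAt_iff_hasFDerivAt, map_smul]
  have h1 : HasFDerivAt (fun y : Rd d => ε • y) (ε • ContinuousLinearMap.id ℝ (Rd d)) x :=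
    (hasFDerivAt_id x).const_smul ε
  refine (hf.hasFDerivAt.comp x h1).congr_fderiv ?_
  ext y
  simp

theorem hasGradientAt_norm_sub_sq (c x : Rd d) :
    HasGradientAt (fun y => ‖y - c‖ ^ 2) ((2 : ℝ) • (x - c)) x := by
  rw [hasGradientAt_iff_hasFDerivAt]
  refine (((hasFDerivAt_id x).sub_const c).norm_sq).congr_fderiv ?_
  ext y
  simp [two_smul]

theorem hasGradientAt_inner_left (p x : Rd d) :
    HasGradientAt (fun y => inner ℝ p y) p x := by
  rw [hasGradientAt_iff_hasFDerivAt]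
  exact (InnerProductSpace.toDual ℝ (Rd d) p).hasFDerivAt

/-- The smooth substitute `√(1 + |x - c|²) - 1` for the distance to `c`. -/
noncomputable def bracket (c x : Rd d) : ℝ := √(1 + ‖x - c‖ ^ 2) - 1

theorem one_le_bracket_root (c x : Rd d) : 1 ≤ √(1 + ‖x - c‖ ^ 2) := by
  rw [Real.one_le_sqrt]; nlinarith [norm_nonneg (x - c)]

theorem bracket_self (c : Rd d) : bracket c c = 0 := by simp [bracket]

theorem bracket_nonneg (c x : Rd d) : 0 ≤ bracket c x := by
  unfold bracket; linarith [one_le_bracket_root c x]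

theorem norm_sub_one_le_bracket (c x : Rd d) : ‖x - c‖ - 1 ≤ bracket c x := by
  unfold bracket
  have : ‖x - c‖ ≤ √(1 + ‖x - c‖ ^ 2) := Real.le_sqrt_of_sq_le (by linarith)
  linarith

theorem contDiff_bracket (c : Rd d) : ContDiff ℝ 1 (bracket c) := by
  unfold bracket
  refine ContDiff.sub (ContDiff.sqrt ?_ fun x => by positivity) contDiff_const
  exact contDiff_const.add ((contDiff_id.sub contDiff_const).norm_sq ℝ)

theorem exists_hasGradientAt_bracket (c x : Rd d) :
    ∃ e : Rd d, ‖e‖ ≤ 1 ∧ HasGradientAt (bracket c) e x := by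
  have h0 : (0 : ℝ) < √(1 + ‖x - c‖ ^ 2) := lt_of_lt_of_le one_pos (one_le_bracket_root c x)
  refine ⟨(√(1 + ‖x - c‖ ^ 2))⁻¹ • (x - c), ?_, ?_⟩
  · rw [norm_smul, norm_inv, Real.norm_of_nonneg h0.le, inv_mul_le_iff₀ h0, mul_one]
    exact Real.le_sqrt_of_sq_le (by linarith)
  · have h1 := (hasGradientAt_norm_sub_sq c x).hasFDerivAt.const_add 1
    have h2 := (h1.sqrt (by positivity)).sub_const 1
    rw [hasGradientAt_iff_hasFDerivAt]
    refine h2.congr_fderiv ?_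
    ext y
    simp [two_smul]
    field_simp
    ring

end Gradient

/-- Viscosity subsolution property of `U_t + G(DU, x) ≤ e` at the points of the set `s`. -/
def IsViscositySubOn {d : ℕ} (G : Rd d → Rd d → ℝ) (e : ℝ) (s : Set (Rd d × ℝ))
    (U : Rd d × ℝ → ℝ) : Prop :=
  ∀ (φ : Rd d × ℝ → ℝ) (x : Rd d) (t : ℝ), (x, t) ∈ s → ContDiff ℝ 1 φ →
    IsLocalMax (fun z => U z - φ z) (x, t) →
    deriv (fun s => φ (x, s)) t + G (gradient (fun y => φ (y, t)) x) x ≤ e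

/-! ### The symmetry `u ↦ -u`, which reduces supersolutions to subsolutions. -/

section Duality

variable {d : ℕ}

/-- The Hamiltonian of the equation satisfied by `-u` when `u` solves the one of `H`. -/
def dualHam {X : Type*} (H : Rd d → X → ℝ) : Rd d → X → ℝ := fun p x => - H (-p) x

theorem gradient_neg_fun (f : Rd d → ℝ) (x : Rd d) :
    gradient (fun y => - f y) x = - gradient f x := by
  have : fderiv ℝ (fun y => - f y) x = - fderiv ℝ f x := fderiv_neg
  simp [gradient, this]

theorem IsLocalMax.neg_sub_neg {X : Type*} [TopologicalSpace X] {f g : X → ℝ} {a : X}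
    (h : IsLocalMax (fun y => - f y - g y) a) : IsLocalMin (fun y => f y - - g y) a := by
  have := h.neg
  refine this.congr (Eventually.of_forall fun y => ?_)
  simp; ring

theorem IsLocalMin.neg_sub_neg {X : Type*} [TopologicalSpace X] {f g : X → ℝ} {a : X}
    (h : IsLocalMin (fun y => - f y - g y) a) : IsLocalMax (fun y => f y - - g y) a := by
  have := h.neg
  refine this.congr (Eventually.of_forall fun y => ?_)
  simp; ring

theorem IsAuxiliarySolution.dual {H : Rd d → Rd d → ℝ} {l : ℝ} {p : Rd d} {v : Rd d → ℝ}
    (h : IsAuxiliarySolution H l p v) :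
    IsAuxiliarySolution (dualHam H) l (-p) (fun x => - v x) where
  continuous := h.continuous.neg
  bounded := by simpa using h.bounded
  sub φ x hφ hm := by
    have := h.super (fun y => - φ y) x hφ.neg hm.neg_sub_neg
    rw [gradient_neg_fun] at this
    simp only [dualHam, neg_add, neg_neg]
    linarith
  super φ x hφ hm := by
    have := h.sub (fun y => - φ y) x hφ.neg hm.neg_sub_neg
    rw [gradient_neg_fun] at this
    simp only [dualHam, neg_add, neg_neg]
    linarith

theorem IsCauchySolution.dual {H : Rd d → Rd d → ℝ} {u₀ : Rd d → ℝ} {u : Rd d → ℝ → ℝ}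
    (h : IsCauchySolution H u₀ u) :
    IsCauchySolution (dualHam H) (fun x => - u₀ x) (fun x t => - u x t) where
  continuousOn := h.continuousOn.neg
  bounded := by simpa using h.bounded
  initial := by simpa using h.initial
  sub φ x t ht hφ hm := by
    have := h.super (fun y => - φ y) x t ht hφ.neg hm.neg_sub_neg
    rw [gradient_neg_fun, deriv.fun_neg] at this
    simp only [dualHam]
    linarith
  super φ x t ht hφ hm := by
    have := h.sub (fun y => - φ y) x t ht hφ.neg hm.neg_sub_neg
    rw [gradient_neg_fun, deriv.fun_neg] at this
    simp only [dualHam]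
    linarith

theorem IsCauchySolution.isViscositySubOn {H : Rd d → Rd d → ℝ} {u₀ : Rd d → ℝ}
    {u : Rd d → ℝ → ℝ} (h : IsCauchySolution H u₀ u) :
    IsViscositySubOn H 0 (univ ×ˢ Ioi 0) (fun z => u z.1 z.2) :=
  fun φ x t ht hφ hm => h.sub φ x t ht.2 hφ hm

end Duality

/-! ### Barriers and control of the initial layer. -/

section Barrier

variable {d : ℕ}

/-- Used for time penalties: a term of size `η` at the reference time exceeds any prescribed bound a
time `a` later. The rate `n` is a real number. -/
theorem exists_nat_mul_exp_ge {η : ℝ} (hη : 0 < η) (a : ℝ) (ha : 0 < a) (B : ℝ) :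
    ∃ n : ℝ, 0 < n ∧ B < η * Real.exp (n * a) := by
  refine ⟨(|B| / η + 1) / a, by positivity, ?_⟩
  have h1 := Real.add_one_le_exp ((|B| / η + 1) / a * a)
  rw [div_mul_cancel₀ _ ha.ne'] at h1 ⊢
  have h2 : η * (|B| / η + 1 + 1) = |B| + 2 * η := by field_simp; ring
  nlinarith [le_abs_self B]

theorem hasDerivAt_exp_penalty (η n T t : ℝ) :
    HasDerivAt (fun s => η * Real.exp (n * (s - T))) (η * n * Real.exp (n * (t - T))) t := by
  have h : HasDerivAt (fun s => n * (s - T)) n t := by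
    simpa using ((hasDerivAt_id t).sub_const T).const_mul n
  exact ((h.exp).const_mul η).congr_deriv (by ring)

/-- The right-hand side is a smooth supersolution, because its spatial gradient has norm at most `K`
and `G ≥ -C` there. A small increasing exponential makes it strict, and growth of `bracket` at
infinity makes the maximum of the difference attained. -/
theorem le_barrier {G : Rd d → Rd d → ℝ} {U : Rd d × ℝ → ℝ} {c : Rd d} {a K C : ℝ}
    (hU : ContinuousOn U (univ ×ˢ Ici 0))
    (hb : ∀ T : ℝ, ∃ B : ℝ, ∀ x, ∀ t ∈ Icc 0 T, U (x, t) ≤ B)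
    (hsub : IsViscositySubOn G 0 (univ ×ˢ Ioi 0) U)
    (hK : 0 < K) (hC : 0 ≤ C) (hG : ∀ p, ‖p‖ ≤ K → ∀ x, -C ≤ G p x)
    (h0 : ∀ x, U (x, 0) ≤ a + K * bracket c x) (x : Rd d) {t : ℝ} (ht : 0 ≤ t) :
    U (x, t) ≤ a + K * bracket c x + C * t := by
  refine le_of_forall_pos_le_add fun η hη => ?_
  obtain ⟨B, hB⟩ := hb (t + 1)
  -- With this rate the penalty equals `η` at time `t` but exceeds `B - a` at time `t + 1`, so the
  -- maximum is not on the final time slice.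
  obtain ⟨n, hn, hnB⟩ := exists_nat_mul_exp_ge hη 1 one_pos (B - a)
  by_contra! hlt
  set ψ : Rd d × ℝ → ℝ := fun z =>
    a + K * bracket c z.1 + C * z.2 + η * Real.exp (n * (z.2 - t)) with hψ
  have hψd : ContDiff ℝ 1 ψ := by
    have := (contDiff_bracket c).comp (contDiff_fst (𝕜 := ℝ) (E := Rd d) (F := ℝ) (n := 1))
    have h2 : ContDiff ℝ 1 fun z : Rd d × ℝ => bracket c z.1 := this
    fun_prop
  -- On the sphere of radius `R` the cone alone exceeds the bound `B`, since `bracket` is at least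
  -- the distance minus one.
  obtain ⟨R, hR⟩ : ∃ R, B - a < K * (R - 1) ∧ ‖x - c‖ ≤ R ∧ 0 ≤ R := by
    refine ⟨|B - a| / K + 2 + ‖x - c‖, ?_, ?_, by positivity⟩
    · have : K * (|B - a| / K + 2 + ‖x - c‖ - 1) = |B - a| + K * (1 + ‖x - c‖) := by
        field_simp; ring
      have : 0 < K * (1 + ‖x - c‖) := by positivity
      linarith [le_abs_self (B - a)]
    · have : 0 ≤ |B - a| / K := by positivity
      linarith
  set S : Set (Rd d × ℝ) := Metric.closedBall c R ×ˢ Icc 0 (t + 1)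
  have hS : IsCompact S := (isCompact_closedBall c R).prod isCompact_Icc
  have hxS : (x, t) ∈ S := ⟨by simpa [dist_eq_norm] using hR.2.1, ht, by linarith⟩
  obtain ⟨⟨y, s⟩, hyS, hmax⟩ := hS.exists_isMaxOn ⟨_, hxS⟩
    (f := fun z => U z - ψ z) ((hU.mono fun z hz => ⟨trivial, hz.2.1⟩).sub hψd.continuous.continuousOn)
  have hpos : 0 < U (y, s) - ψ (y, s) := by
    have := hmax hxS
    simp only [hψ, mem_ofPred_eq, sub_self, mul_zero, Real.exp_zero, mul_one] at this ⊢
    linarith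
  have hs0 : 0 ≤ s := hyS.2.1
  have hUB := hB y s hyS.2
  have hbr := bracket_nonneg c y
  have hex : 0 < η * Real.exp (n * (s - t)) := by positivity
  have hs : 0 < s := by
    rcases hs0.eq_or_lt with h | h
    · subst h
      have := h0 y
      simp only [hψ] at hpos
      linarith
    · exact h
  have hs1 : s < t + 1 := by
    rcases hyS.2.2.eq_or_lt with h | h
    · simp only at h
      subst h
      simp only [hψ, add_sub_cancel_left] at hpos
      have := mul_nonneg hK.le hbr
      have := mul_nonneg hC hs0
      linarith
    · exact h
  have hyR : dist y c < R := by
    rcases (Metric.mem_closedBall.1 hyS.1).eq_or_lt with h | h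
    · simp only [dist_eq_norm] at h
      have h1 := norm_sub_one_le_bracket c y
      rw [h] at h1
      simp only [hψ] at hpos
      have := mul_le_mul_of_nonneg_left h1 hK.le
      have := mul_nonneg hC hs0
      linarith
    · exact h
  have hloc : IsLocalMax (fun z => U z - ψ z) (y, s) :=
    hmax.isLocalMax (prod_mem_nhds (Metric.closedBall_mem_nhds_of_mem hyR) (Icc_mem_nhds hs hs1))
  have key := hsub ψ y s ⟨trivial, hs⟩ hψd hloc
  obtain ⟨e, he, hge⟩ := exists_hasGradientAt_bracket c y
  have hg : HasGradientAt (fun y => ψ (y, s)) (K • e) y := by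
    have h1 := (hge.const_mul_gradient K).add_gradient
      (hasGradientAt_const y (a + C * s + η * Real.exp (n * (s - t))))
    rw [add_zero] at h1
    convert h1 using 2
    simp only [hψ]; ring
  have hd : HasDerivAt (fun s => ψ (y, s)) (C + η * n * Real.exp (n * (s - t))) s := by
    have h1 := (((hasDerivAt_id s).const_mul C).const_add (a + K * bracket c y)).add
      (hasDerivAt_exp_penalty η n t s)
    exact h1.congr_deriv (by ring)
  rw [hg.gradient, hd.deriv] at key
  have hke : ‖K • e‖ ≤ K := by
    rw [norm_smul, Real.norm_of_nonneg hK.le]; nlinarith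
  have := hG _ hke y
  have : 0 < η * n * Real.exp (n * (s - t)) := by positivity
  linarith

/-- A bounded uniformly continuous function lies below a family of smooth cones of equal slope. -/
theorem exists_slope_of_uniformContinuous {u₀ : Rd d → ℝ} (hu₀ : UniformContinuous u₀)
    (hb : ∃ C : ℝ, ∀ x, |u₀ x| ≤ C) {η : ℝ} (hη : 0 < η) :
    ∃ K > 0, ∀ c x, u₀ x ≤ u₀ c + η + K * bracket c x := by
  obtain ⟨M, hM⟩ := hb
  obtain ⟨δ, hδ, h⟩ := Metric.uniformContinuous_iff.1 hu₀ η hη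
  have hM0 : 0 ≤ M := (abs_nonneg _).trans (hM 0)
  have hk : 0 < √(1 + δ ^ 2) - 1 := by
    rw [sub_pos, Real.lt_sqrt zero_le_one]; nlinarith
  -- Within distance `δ` uniform continuity suffices; beyond it the cone has risen by at least `2 *
  -- M + 1`, more than the oscillation of `u₀`.
  refine ⟨(2 * M + 1) / (√(1 + δ ^ 2) - 1), by positivity, fun c x => ?_⟩
  rcases lt_or_ge (dist x c) δ with h1 | h1
  · have h2 := h h1
    rw [Real.dist_eq] at h2
    have := mul_nonneg (div_pos (by positivity : 0 < 2 * M + 1) hk).le (bracket_nonneg c x)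
    linarith [le_abs_self (u₀ x - u₀ c)]
  · have h2 : √(1 + δ ^ 2) - 1 ≤ bracket c x := by
      unfold bracket
      rw [dist_eq_norm] at h1
      gcongr
    have h3 : 2 * M + 1 ≤ (2 * M + 1) / (√(1 + δ ^ 2) - 1) * bracket c x := by
      rw [div_mul_eq_mul_div, le_div_iff₀ hk]
      gcongr
    linarith [(abs_le.1 (hM x)).2, (abs_le.1 (hM c)).1]

/-- `U` leaves its initial values at a controlled speed, uniformly in space. -/
def HasInitialGrowth (u₀ : Rd d → ℝ) (U : Rd d × ℝ → ℝ) (C : ℝ → ℝ) : Prop :=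
  ∀ η > 0, 0 ≤ C η ∧ ∀ x, ∀ t ≥ 0, U (x, t) ≤ u₀ x + η + C η * t

/-- The growth rate depends only on the initial datum and on local bounds of the Hamiltonian. -/
theorem exists_hasInitialGrowth {u₀ : Rd d → ℝ} (hu₀ : UniformContinuous u₀)
    (hb : ∃ C : ℝ, ∀ x, |u₀ x| ≤ C) (D : ℝ → ℝ) :
    ∃ C : ℝ → ℝ, ∀ (G : Rd d → Rd d → ℝ) (u : Rd d → ℝ → ℝ),
      (∀ r p x, ‖p‖ ≤ r → |G p x| ≤ D r) → IsCauchySolution G u₀ u →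
      HasInitialGrowth u₀ (fun z => u z.1 z.2) C := by
  choose! K hK hslope using fun η (hη : (0 : ℝ) < η) => exists_slope_of_uniformContinuous hu₀ hb hη
  refine ⟨fun η => |D (K η)|, fun G u hG hu η hη => ⟨abs_nonneg _, fun x t ht => ?_⟩⟩
  have := le_barrier (c := x) (a := u₀ x + η) (K := K η) (C := |D (K η)|) hu.continuousOn
    (fun T => (hu.bounded T).imp fun B hB x t ht => (abs_le.1 (hB x t ht)).2)
    hu.isViscositySubOn (hK η hη) (abs_nonneg _)
    (fun p hp x => by
      have := hG _ p x hp
      linarith [neg_abs_le (G p x), le_abs_self (D (K η))])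
    (fun y => by simpa [hu.initial] using hslope η hη x y) x ht
  simpa [bracket_self] using this

end Barrier

/-! ### Comparison principle for Hamiltonians independent of position. -/

section Comparison

variable {d : ℕ}

theorem hasDerivAt_const_mul_sub_sq (N s t : ℝ) :
    HasDerivAt (fun r => N * (r - s) ^ 2) (N * (2 * (t - s))) t := by
  have h := ((((hasDerivAt_id t).sub_const s).pow 2).const_mul N)
  exact h.congr_deriv (by simp)

theorem sq_le_of_mul_sq_le {N δ a : ℝ} (hN : 0 < N) (hδ : 0 ≤ δ) (h : N * a ^ 2 ≤ N * δ ^ 2) :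
    |a| ≤ δ :=
  abs_le_of_sq_le_sq (le_of_mul_le_mul_left h hN) hδ

theorem HasInitialGrowth.le_bound {u₀ : Rd d → ℝ} {U : Rd d × ℝ → ℝ} {C : ℝ → ℝ} {M : ℝ}
    (h : HasInitialGrowth u₀ U C) (hM : ∀ x, u₀ x ≤ M) (T : ℝ) (x : Rd d)
    (t : ℝ) (ht : t ∈ Icc 0 T) : U (x, t) ≤ M + 1 + C 1 * T := by
  have h1 := (h 1 one_pos).2 x t ht.1
  have h2 := mul_le_mul_of_nonneg_left ht.2 (h 1 one_pos).1
  linarith [hM x]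

set_option maxHeartbeats 800000 in
/-- Comparison principle, for a subsolution `U` and the negative `W` of a supersolution. -/
theorem add_le_zero_of_isViscositySubOn {G : Rd d → ℝ} (hG : Continuous G) {u₀ : Rd d → ℝ}
    (hu₀ : UniformContinuous u₀) (hu₀b : ∃ C : ℝ, ∀ x, |u₀ x| ≤ C)
    {U W : Rd d × ℝ → ℝ} {C C' : ℝ → ℝ}
    (hU : UpperSemicontinuousOn U (univ ×ˢ Ici 0)) (hW : UpperSemicontinuousOn W (univ ×ˢ Ici 0))
    (hUs : IsViscositySubOn (fun p _ => G p) 0 (univ ×ˢ Ioi 0) U)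
    (hWs : IsViscositySubOn (dualHam fun p _ => G p) 0 (univ ×ˢ Ioi 0) W)
    (hUi : HasInitialGrowth u₀ U C) (hWi : HasInitialGrowth (fun x => - u₀ x) W C')
    (x₁ : Rd d) {T : ℝ} (hT : 0 ≤ T) : U (x₁, T) + W (x₁, T) ≤ 0 := by
  by_contra! hσ
  set σ := U (x₁, T) + W (x₁, T) with hσdef
  obtain ⟨M, hM⟩ := hu₀b
  obtain ⟨B₁, hB₁⟩ : ∃ B : ℝ, ∀ x, ∀ t ∈ Icc 0 (T + 1), U (x, t) ≤ B :=
    ⟨_, hUi.le_bound (fun x => (abs_le.1 (hM x)).2) (T + 1)⟩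
  obtain ⟨B₂, hB₂⟩ : ∃ B : ℝ, ∀ x, ∀ t ∈ Icc 0 (T + 1), W (x, t) ≤ B :=
    ⟨_, hWi.le_bound (M := M) (fun x => by linarith [(abs_le.1 (hM x)).1]) (T + 1)⟩
  set B := B₁ + B₂ with hBdef
  have hTT : T ∈ Icc 0 (T + 1) := ⟨hT, by linarith⟩
  have hB : 0 < B := by linarith [hB₁ x₁ T hTT, hB₂ x₁ T hTT]
  obtain ⟨n, hn, hnB⟩ := exists_nat_mul_exp_ge (half_pos hσ) (1 / 2) (by norm_num) B
  obtain ⟨hC, hUC⟩ := hUi (σ / 16) (by positivity)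
  obtain ⟨hC', hWC⟩ := hWi (σ / 16) (by positivity)
  obtain ⟨δ₀, hδ₀, hδu⟩ := Metric.uniformContinuous_iff.1 hu₀ (σ / 16) (by positivity)
  -- `δ` will bound the distance between the doubled points: below `1 / 2` to keep both times under
  -- `T + 1`, and small enough that the initial layer of width `δ` contributes at most `σ / 4`.
  obtain ⟨δ, hδ, hδ2, hδδ, hδC⟩ : ∃ δ > 0, δ < 1 / 2 ∧ δ < δ₀ ∧
      (C (σ / 16) + C' (σ / 16)) * δ ≤ σ / 16 := by
    set k := C (σ / 16) + C' (σ / 16) with hk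
    have hk0 : 0 ≤ k := by positivity
    refine ⟨min (min (1 / 4) (δ₀ / 2)) (σ / 16 / (k + 1)), by positivity, ?_, ?_, ?_⟩
    · linarith [min_le_left (min (1 / 4) (δ₀ / 2)) (σ / 16 / (k + 1)),
        min_le_left (1 / 4) (δ₀ / 2)]
    · linarith [min_le_left (min (1 / 4) (δ₀ / 2)) (σ / 16 / (k + 1)),
        min_le_right (1 / 4) (δ₀ / 2)]
    · calc k * min (min (1 / 4) (δ₀ / 2)) (σ / 16 / (k + 1)) ≤ k * (σ / 16 / (k + 1)) := by
            gcongr; exact min_le_right _ _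
        _ ≤ (k + 1) * (σ / 16 / (k + 1)) := by gcongr; linarith
        _ = σ / 16 := by field_simp
  obtain ⟨N, hN, hNB⟩ : ∃ N > 0, N * δ ^ 2 = B := ⟨B / δ ^ 2, by positivity, by field_simp⟩
  -- The least time derivative of the exponential penalty over `t ≥ 0`: the strictness margin. Next,
  -- `β` is taken so small that the localization shifts `G` by less than this.
  set κ := σ / 2 * n * Real.exp (n * (0 - T)) with hκdef
  have hκ : 0 < κ := by positivity
  obtain ⟨β, hβ, hβG⟩ : ∃ β : ℝ, 0 < β ∧ ∀ P e : Rd d, ‖P‖ ≤ 2 * N * δ → ‖e‖ ≤ 1 →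
      G P - G (P + β • e) < κ := by
    have huc := (isCompact_closedBall (0 : Rd d) (2 * N * δ + 1)).uniformContinuousOn_of_continuous
      hG.continuousOn
    obtain ⟨b, hb, hbG⟩ := Metric.uniformContinuousOn_iff.1 huc κ hκ
    refine ⟨min 1 (b / 2), by positivity, fun P e hP he => ?_⟩
    have hβe : ‖min 1 (b / 2) • e‖ ≤ min 1 (b / 2) := by
      rw [norm_smul, Real.norm_of_nonneg (by positivity)]
      exact mul_le_of_le_one_right (by positivity) he
    have h1 := hbG P (by simp; linarith) (P + min 1 (b / 2) • e) (by
      simp only [mem_closedBall_zero_iff]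
      linarith [norm_add_le P (min 1 (b / 2) • e), min_le_left 1 (b / 2)]) (by
      rw [dist_self_add_right]
      linarith [min_le_right 1 (b / 2)])
    rw [Real.dist_eq] at h1
    exact (le_abs_self _).trans_lt h1
  obtain ⟨R, hR0, hR⟩ : ∃ R ≥ 0, B < β * (R - 1) :=
    ⟨B / β + 2, by positivity, by
      have : β * (B / β + 2 - 1) = B + β := by field_simp; ring
      linarith⟩
  set pen : Rd d × ℝ → Rd d × ℝ → ℝ := fun z w =>
    N * ‖z.1 - w.1‖ ^ 2 + N * (z.2 - w.2) ^ 2 with hpen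
  set loc : Rd d × ℝ → ℝ := fun z => β * bracket x₁ z.1 + σ / 2 * Real.exp (n * (z.2 - T))
    with hloc
  have hlocd : ContDiff ℝ 1 loc := by
    have h2 : ContDiff ℝ 1 fun z : Rd d × ℝ => bracket x₁ z.1 :=
      (contDiff_bracket x₁).comp contDiff_fst
    fun_prop
  have hpend : ∀ w, ContDiff ℝ 1 fun z => pen z w := fun w => by
    have h2 : ContDiff ℝ 1 fun z : Rd d × ℝ => ‖z.1 - w.1‖ ^ 2 :=
      (contDiff_fst.sub contDiff_const).norm_sq ℝ
    fun_prop
  set S₁ : Set (Rd d × ℝ) := Metric.closedBall x₁ R ×ˢ Icc 0 (T + 1)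
  -- The radius is larger by one because only the first point is localized; the second stays within
  -- `δ` of it and so is interior.
  set S₂ : Set (Rd d × ℝ) := Metric.closedBall x₁ (R + 1) ×ˢ Icc 0 (T + 1)
  have hS : IsCompact (S₁ ×ˢ S₂) := ((isCompact_closedBall _ _).prod isCompact_Icc).prod
    ((isCompact_closedBall _ _).prod isCompact_Icc)
  have hz₁ : ((x₁, T), (x₁, T)) ∈ S₁ ×ˢ S₂ :=
    ⟨⟨by simpa using hR0, hTT⟩, ⟨by simp; linarith, hTT⟩⟩
  have husc : UpperSemicontinuousOn (fun Z : (Rd d × ℝ) × (Rd d × ℝ) =>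
      U Z.1 + W Z.2 + -(pen Z.1 Z.2 + loc Z.1)) (S₁ ×ˢ S₂) := by
    refine ((hU.comp continuousOn_fst ?_).add (hW.comp continuousOn_snd ?_)).add
      (Continuous.continuousOn ?_).upperSemicontinuousOn
    · exact fun Z hZ => ⟨trivial, hZ.1.2.1⟩
    · exact fun Z hZ => ⟨trivial, hZ.2.2.1⟩
    · have := hlocd.continuous
      fun_prop
  obtain ⟨⟨⟨x, t⟩, ⟨y, s⟩⟩, hmem, hmax⟩ := husc.exists_isMaxOn ⟨_, hz₁⟩ hS
  -- Testing at the diagonal point over `(x₁, T)` costs only the exponential term, which is `σ / 2`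
  -- there.
  have hval : σ / 2 ≤ U (x, t) + W (y, s) + -(pen (x, t) (y, s) + loc (x, t)) := by
    have := hmax hz₁
    simp only [mem_ofPred_eq, hpen, hloc, bracket_self, sub_self, mul_zero, Real.exp_zero] at this
    simp only [hpen, hloc]
    norm_num at this
    linarith
  obtain ⟨⟨hx, ht⟩, ⟨hy, hs⟩⟩ := hmem
  simp only at hx ht hy hs
  have hUB := hB₁ x t ht
  have hWB := hB₂ y s hs
  have hbr := mul_nonneg hβ.le (bracket_nonneg x₁ x)
  have hexp : 0 < σ / 2 * Real.exp (n * (t - T)) := by positivity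
  have hp1 : 0 ≤ N * ‖x - y‖ ^ 2 := by positivity
  have hp2 : 0 ≤ N * (t - s) ^ 2 := by positivity
  simp only [hpen, hloc] at hval
  have hxy : ‖x - y‖ ≤ δ := by
    simpa using sq_le_of_mul_sq_le (a := ‖x - y‖) hN hδ.le (by linarith)
  have hts : |t - s| ≤ δ := sq_le_of_mul_sq_le hN hδ.le (by linarith)
  obtain ⟨hts1, hts2⟩ := abs_le.1 hts
  have htT : t < T + 1 / 2 := by
    by_contra! h
    have : Real.exp (n * (1 / 2)) ≤ Real.exp (n * (t - T)) := by
      gcongr; linarith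
    have := mul_le_mul_of_nonneg_left this (half_pos hσ).le
    linarith
  -- In the initial layer `U + W` is at most four errors of `σ / 16`, below the maximal value. As
  -- `|t - s| ≤ δ`, this forbids either time from vanishing.
  have hinit : ¬ (t ≤ δ ∧ s ≤ δ) := by
    rintro ⟨h1, h2⟩
    have h3 := hUC x t ht.1
    have h4 := hWC y s hs.1
    have h5 := hδu (a := x) (b := y) (by rw [dist_eq_norm]; linarith)
    rw [Real.dist_eq] at h5
    have h6 := mul_le_mul_of_nonneg_left h1 hC
    have h7 := mul_le_mul_of_nonneg_left h2 hC'
    linarith [le_abs_self (u₀ x - u₀ y)]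
  have ht0 : 0 < t := by
    rcases ht.1.eq_or_lt with h | h
    · exact absurd ⟨by linarith, by linarith⟩ hinit
    · exact h
  have hs0 : 0 < s := by
    rcases hs.1.eq_or_lt with h | h
    · exact absurd ⟨by linarith, by linarith⟩ hinit
    · exact h
  have hxR : dist x x₁ < R := by
    by_contra! h
    rw [dist_eq_norm] at h
    have h1 := norm_sub_one_le_bracket x₁ x
    have := mul_le_mul_of_nonneg_left ((sub_le_sub_right h 1).trans h1) hβ.le
    linarith
  have hyR : dist y x₁ < R + 1 := by
    have := dist_triangle y x x₁
    rw [dist_comm y x, dist_eq_norm x y] at this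
    linarith
  have hS₁ : S₁ ∈ 𝓝 (x, t) :=
    prod_mem_nhds (Metric.closedBall_mem_nhds_of_mem hxR) (Icc_mem_nhds ht0 (by linarith))
  have hS₂ : S₂ ∈ 𝓝 (y, s) :=
    prod_mem_nhds (Metric.closedBall_mem_nhds_of_mem hyR) (Icc_mem_nhds hs0 (by linarith))
  have hm₁ : IsLocalMax (fun z => U z - (pen z (y, s) + loc z)) (x, t) := by
    filter_upwards [hS₁] with z hz
    have := hmax (⟨hz, ⟨hy, hs⟩⟩ : (z, (y, s)) ∈ S₁ ×ˢ S₂)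
    simp only [mem_ofPred_eq] at this
    linarith
  have hm₂ : IsLocalMax (fun w => W w - pen w (x, t)) (y, s) := by
    filter_upwards [hS₂] with w hw
    have := hmax (⟨⟨hx, ht⟩, hw⟩ : ((x, t), w) ∈ S₁ ×ˢ S₂)
    have hsymm : ∀ w, pen w (x, t) = pen (x, t) w := fun w => by
      simp only [hpen, norm_sub_rev w.1 x]; ring
    simp only [mem_ofPred_eq] at this
    rw [hsymm, hsymm]
    linarith
  have key₁ := hUs _ x t ⟨trivial, ht0⟩ ((hpend (y, s)).add hlocd) hm₁
  have key₂ := hWs _ y s ⟨trivial, hs0⟩ (hpend (x, t)) hm₂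
  have hpg : ∀ (a b : Rd d) (r r' : ℝ),
      HasGradientAt (fun a => pen (a, r) (b, r')) (N • (2 : ℝ) • (a - b)) a := fun a b r r' => by
    have := ((hasGradientAt_norm_sub_sq b a).const_mul_gradient N).add_gradient
      (hasGradientAt_const a (N * (r - r') ^ 2))
    rwa [add_zero] at this
  have hpt : ∀ (a b : Rd d) (r r' : ℝ),
      HasDerivAt (fun r => pen (a, r) (b, r')) (N * (2 * (r - r'))) r := fun a b r r' =>
    (hasDerivAt_const_mul_sub_sq N r' r).const_add (N * ‖a - b‖ ^ 2)
  obtain ⟨e, he, hge⟩ := exists_hasGradientAt_bracket x₁ x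
  have hlg : HasGradientAt (fun a => loc (a, t)) (β • e) x := by
    have := (hge.const_mul_gradient β).add_gradient
      (hasGradientAt_const x (σ / 2 * Real.exp (n * (t - T))))
    rwa [add_zero] at this
  have hlt : HasDerivAt (fun r => loc (x, r)) (σ / 2 * n * Real.exp (n * (t - T))) t :=
    (hasDerivAt_exp_penalty (σ / 2) n T t).const_add (β * bracket x₁ x)
  rw [((hpg x y t s).add_gradient hlg).gradient, ((hpt x y t s).fun_add hlt).deriv] at key₁
  rw [(hpg y x s t).gradient, (hpt y x s t).deriv] at key₂
  have hneg : -(N • (2 : ℝ) • (y - x)) = N • (2 : ℝ) • (x - y) := by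
    rw [← smul_neg, ← smul_neg, neg_sub]
  simp only [dualHam, hneg] at key₂
  have hPn : ‖N • (2 : ℝ) • (x - y)‖ ≤ 2 * N * δ := by
    rw [norm_smul, norm_smul, Real.norm_of_nonneg hN.le, Real.norm_of_nonneg zero_le_two]
    calc N * (2 * ‖x - y‖) ≤ N * (2 * δ) := by gcongr
      _ = 2 * N * δ := by ring
  have hlast := hβG _ e hPn he
  have hexp2 : κ ≤ σ / 2 * n * Real.exp (n * (t - T)) := by
    rw [hκdef]; gcongr
  linarith

end Comparison

/-! ### The perturbed test function argument. -/

section PerturbedTest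

variable {d : ℕ}

/-- The properties of a single realization of the random Hamiltonian that homogenization uses. -/
structure IsAdmissible (H : Rd d → Rd d → ℝ) : Prop where
  unif : ∀ R η : ℝ, 0 < η → ∃ s > 0, ∀ P Q : Rd d, ‖P‖ ≤ R → ‖Q‖ ≤ R → ∀ x y : Rd d,
    ‖P - Q‖ ≤ s → ‖x - y‖ ≤ s → |H P x - H Q y| ≤ η
  bounded : ∀ R : ℝ, ∃ C : ℝ, ∀ P, ‖P‖ ≤ R → ∀ x, |H P x| ≤ C
  coercive : ∀ M : ℝ, ∃ R : ℝ, ∀ P, R ≤ ‖P‖ → ∀ x, M < |H P x|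

/-- The conclusion of regular homogenizability at `p` for a single realization. -/
def HomogenizesAt (H : Rd d → Rd d → ℝ) (p : Rd d) (h : ℝ) : Prop :=
  ∃ v : ℝ → Rd d → ℝ, (∀ l > 0, IsAuxiliarySolution H l p (v l)) ∧
    ∀ R > 0, ∀ δ > 0, ∀ᶠ l in 𝓝[>] (0 : ℝ), ∀ x, ‖x‖ ≤ R / l → |l * v l x + h| ≤ δ

theorem IsAdmissible.dual {H : Rd d → Rd d → ℝ} (hH : IsAdmissible H) :
    IsAdmissible (dualHam H) where
  unif R η hη := by
    obtain ⟨s, hs, h⟩ := hH.unif R η hη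
    refine ⟨s, hs, fun P Q hP hQ x y hPQ hxy => ?_⟩
    have := h (-P) (-Q) (by simpa) (by simpa) x y
      (by rwa [neg_sub_neg, norm_sub_rev]) hxy
    simp only [dualHam]
    rwa [neg_sub_neg, abs_sub_comm]
  bounded R := by
    obtain ⟨C, h⟩ := hH.bounded R
    exact ⟨C, fun P hP x => by simpa [dualHam] using h (-P) (by simpa) x⟩
  coercive M := by
    obtain ⟨R, h⟩ := hH.coercive M
    exact ⟨R, fun P hP x => by simpa [dualHam] using h (-P) (by simpa) x⟩

theorem HomogenizesAt.dual {H : Rd d → Rd d → ℝ} {p : Rd d} {h : ℝ} (hp : HomogenizesAt H p h) :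
    HomogenizesAt (dualHam H) (-p) (-h) := by
  obtain ⟨v, hv, hl⟩ := hp
  refine ⟨fun l x => - v l x, fun l hl0 => (hv l hl0).dual, fun R hR δ hδ => ?_⟩
  filter_upwards [hl R hR δ hδ] with l h1 x hx
  rw [← abs_neg]
  convert h1 x hx using 2
  ring

theorem IsAdmissible.continuous {H : Rd d → Rd d → ℝ} (hH : IsAdmissible H) :
    Continuous fun z : Rd d × Rd d => H z.1 z.2 := by
  rw [continuous_iff_continuousAt]
  intro z
  rw [Metric.continuousAt_iff]
  intro η hη
  obtain ⟨s, hs, h⟩ := hH.unif (‖z.1‖ + 1) (η / 2) (by positivity)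
  refine ⟨min s 1, by positivity, fun w hw => ?_⟩
  have h1 : dist w.1 z.1 < min s 1 := (le_max_left _ _).trans_lt hw
  have h2 : dist w.2 z.2 < min s 1 := (le_max_right _ _).trans_lt hw
  rw [dist_eq_norm] at h1 h2
  have h3 : ‖w.1‖ ≤ ‖z.1‖ + 1 := by
    linarith [norm_sub_norm_le w.1 z.1, min_le_right s 1]
  have := h w.1 z.1 h3 (by linarith) w.2 z.2 (by linarith [min_le_left s 1])
    (by linarith [min_le_left s 1])
  rw [Real.dist_eq]
  linarith

/-- Outside of a large ball a coercive continuous Hamiltonian cannot change its sign. -/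
theorem not_sign_change {H : Rd d → Rd d → ℝ}
    (hH : Continuous fun z : Rd d × Rd d => H z.1 z.2) {R M : ℝ} (hM : 0 ≤ M)
    (hR : ∀ P, R ≤ ‖P‖ → ∀ x, M < |H P x|) {P Q x y : Rd d} (hP : R + ‖Q - P‖ ≤ ‖P‖)
    (h1 : H P x ≤ M) (h2 : -M ≤ H Q y) : False := by
  -- The whole segment stays in the region where `|H| > M`, so a zero of `H` along it, provided by
  -- the intermediate value theorem, is impossible.
  have hsegm : ∀ s ∈ Icc (0 : ℝ) 1, R ≤ ‖P + s • (Q - P)‖ := fun s hs => by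
    have h3 : ‖s • (Q - P)‖ ≤ ‖Q - P‖ := by
      rw [norm_smul, Real.norm_of_nonneg hs.1]
      exact mul_le_of_le_one_left (norm_nonneg _) hs.2
    have h4 := norm_sub_norm_le P (-(s • (Q - P)))
    rw [norm_neg, sub_neg_eq_add] at h4
    linarith
  set f : ℝ → ℝ := fun s => H (P + s • (Q - P)) (x + s • (y - x)) with hf
  have hfc : Continuous f := hH.comp (f := fun s : ℝ => (P + s • (Q - P), x + s • (y - x)))
    (by fun_prop)
  have hf0 : f 0 = H P x := by simp [hf]
  have hf1 : f 1 = H Q y := by simp [hf]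
  have hlt0 : f 0 ≤ 0 := by
    have := hR _ (hsegm 0 ⟨le_rfl, zero_le_one⟩) (x + (0 : ℝ) • (y - x))
    rcases lt_abs.1 this with h | h
    · exact absurd (hf0.trans_le h1) (not_le.2 h)
    · change M < - f 0 at h
      linarith
  have hlt1 : 0 ≤ f 1 := by
    have := hR _ (hsegm 1 ⟨zero_le_one, le_rfl⟩) (x + (1 : ℝ) • (y - x))
    rcases lt_abs.1 this with h | h
    · change M < f 1 at h
      linarith
    · change M < - f 1 at h
      linarith
  obtain ⟨s, hs, hs0⟩ := intermediate_value_Icc zero_le_one hfc.continuousOn ⟨hlt0, hlt1⟩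
  have := hR _ (hsegm s hs) (x + s • (y - x))
  change M < |f s| at this
  rw [hs0, abs_zero] at this
  linarith

/-- Doubling of the space variable for `u - φ` against a corrector `v` at scale `ε`. -/
theorem exists_doubling_max {u φ : Rd d × ℝ → ℝ} {v : Rd d → ℝ} {z₀ : Rd d × ℝ}
    {r ε c gap δ h tol : ℝ} (hr : 0 < r) (hε : 0 < ε)
    (hu : ContinuousOn u (Metric.closedBall z₀ r)) (hφ : Continuous φ) (hv : Continuous v)
    (hvh : ∀ y, ‖ε • y‖ ≤ ‖z₀.1‖ + 2 * r → |ε * v y + h| ≤ δ) (hδ : 2 * δ < gap)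
    (hsph : ∀ z ∈ Metric.sphere z₀ r, u z - φ z ≤ c - gap)
    {z₁ : Rd d × ℝ} (hz₁ : z₁ ∈ Metric.ball z₀ r) (hcen : c ≤ u z₁ - φ z₁) (htol : 0 < tol) :
    ∃ N > 0, ∃ (x : Rd d) (t : ℝ) (y : Rd d), (x, t) ∈ Metric.ball z₀ r ∧ ‖x - ε • y‖ ≤ tol ∧
      |ε * v y + h| ≤ δ ∧
      IsLocalMax (fun z : Rd d × ℝ => u z - (φ z + N * ‖z.1 - ε • y‖ ^ 2)) (x, t) ∧
      IsLocalMin (fun w => v w - (-(N / ε)) * ‖ε • w - x‖ ^ 2) y := by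
  obtain ⟨x₀, t₀⟩ := z₀
  have hsc : ∀ y : Rd d, ε * ‖y - ε⁻¹ • x₀‖ = ‖ε • y - x₀‖ := fun y => by
    rw [← Real.norm_of_nonneg hε.le, ← norm_smul, Real.norm_of_nonneg hε.le, smul_sub,
      smul_inv_smul₀ hε.ne']
  obtain ⟨B, hB⟩ := (isCompact_closedBall (x₀, t₀) r).bddAbove_image
    (hu.sub hφ.continuousOn)
  have hB' : ∀ z ∈ Metric.closedBall (x₀, t₀) r, u z - φ z ≤ B := fun z hz =>
    hB ⟨z, hz, rfl⟩
  have hcB : c ≤ B := hcen.trans (hB' z₁ (Metric.ball_subset_closedBall hz₁))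
  set τ := min tol (r / 2) with hτ
  have hτ0 : 0 < τ := by positivity
  have hδ0 : 0 ≤ δ := (abs_nonneg _).trans (hvh (ε⁻¹ • x₀) (by
    rw [smul_inv_smul₀ hε.ne']; simp; linarith))
  -- `B - c` bounds what `u - φ` can gain over its value at `z₁`, and `2 * δ` the oscillation of `ε
  -- v`. The penalty at the maximum is thus less than `N * τ ^ 2`.
  obtain ⟨N, hN, hNB⟩ : ∃ N > 0, N * τ ^ 2 = B - c + 2 * δ + 1 :=
    ⟨(B - c + 2 * δ + 1) / τ ^ 2, div_pos (by linarith) (by positivity), by field_simp⟩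
  set S := Metric.closedBall (x₀, t₀) r ×ˢ Metric.closedBall (ε⁻¹ • x₀) (2 * r / ε)
  have hS : IsCompact S := (isCompact_closedBall _ _).prod (isCompact_closedBall _ _)
  have hSy : ∀ y, y ∈ Metric.closedBall (ε⁻¹ • x₀) (2 * r / ε) ↔ ‖ε • y - x₀‖ ≤ 2 * r :=
    fun y => by
      rw [mem_closedBall_iff_norm, le_div_iff₀ hε, mul_comm, hsc]
  have hvy : ∀ y, ‖ε • y - x₀‖ ≤ 2 * r → |ε * v y + h| ≤ δ := fun y hy =>
    hvh y (by simp only; linarith [norm_sub_norm_le (ε • y) x₀])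
  have hz₁r : ‖z₁.1 - x₀‖ < r := by
    rw [← dist_eq_norm]; exact (le_max_left _ _).trans_lt hz₁
  have hmem₁ : (z₁, ε⁻¹ • z₁.1) ∈ S :=
    ⟨Metric.ball_subset_closedBall hz₁, (hSy _).2 (by rw [smul_inv_smul₀ hε.ne']; linarith)⟩
  obtain ⟨⟨⟨x, t⟩, y⟩, hmem, hmax⟩ := hS.exists_isMaxOn ⟨_, hmem₁⟩
    (f := fun Z : (Rd d × ℝ) × Rd d => (u Z.1 - φ Z.1) - ε * v Z.2 - N * ‖Z.1.1 - ε • Z.2‖ ^ 2)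
    ((((hu.sub hφ.continuousOn).comp continuousOn_fst fun Z hZ => hZ.1).sub
      (by fun_prop)).sub (by fun_prop))
  obtain ⟨hxt, hy⟩ := hmem
  simp only at hxt hy
  have hyb := (hSy y).1 hy
  have hval := hmax hmem₁
  simp only [mem_ofPred_eq, smul_inv_smul₀ hε.ne', sub_self, norm_zero] at hval
  have hv1 := abs_le.1 (hvy _ (by rw [smul_inv_smul₀ hε.ne']; linarith :
    ‖ε • ε⁻¹ • z₁.1 - x₀‖ ≤ 2 * r))
  have hv2 := abs_le.1 (hvy y hyb)
  have hpen : 0 ≤ N * ‖x - ε • y‖ ^ 2 := by positivity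
  have hxy : ‖x - ε • y‖ ≤ τ := by
    have h1 : N * ‖x - ε • y‖ ^ 2 ≤ N * τ ^ 2 := by
      rw [hNB]
      linarith [hB' _ hxt]
    simpa using abs_le_of_sq_le_sq (le_of_mul_le_mul_left h1 hN) hτ0.le
  -- On the sphere the loss `gap` exceeds the oscillation `2 * δ` of the corrector.
  have hball : (x, t) ∈ Metric.ball (x₀, t₀) r := by
    rcases (Metric.mem_closedBall.1 hxt).eq_or_lt with h1 | h1
    · have := hsph _ (Metric.mem_sphere.2 h1)
      linarith
    · exact h1
  have hxr : ‖x - x₀‖ < r := by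
    rw [← dist_eq_norm]; exact (le_max_left _ _).trans_lt hball
  have hyi : ‖ε • y - x₀‖ < 2 * r := by
    have h1 := norm_sub_le_norm_sub_add_norm_sub (ε • y) x x₀
    rw [norm_sub_rev (ε • y) x] at h1
    linarith [min_le_right tol (r / 2)]
  refine ⟨N, hN, x, t, y, hball, hxy.trans (min_le_left _ _), hvy y hyb, ?_, ?_⟩
  · filter_upwards [Metric.closedBall_mem_nhds_of_mem hball] with z hz
    have := hmax (⟨hz, hy⟩ : (z, y) ∈ S)
    simp only [mem_ofPred_eq] at this
    linarith
  · have hopen : IsOpen {w : Rd d | ‖ε • w - x₀‖ < 2 * r} :=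
      isOpen_lt (by fun_prop) continuous_const
    filter_upwards [hopen.mem_nhds hyi] with w hw
    have := hmax (⟨hxt, (hSy w).2 (le_of_lt hw)⟩ : ((x, t), w) ∈ S)
    simp only [mem_ofPred_eq] at this
    rw [norm_sub_rev (ε • y), norm_sub_rev (ε • w)]
    refine le_of_mul_le_mul_left ?_ hε
    have e1 : ∀ a b : ℝ, ε * (a - -(N / ε) * b) = ε * a + N * b := fun a b => by
      field_simp; ring
    rw [e1, e1]
    linarith

/-- Time derivative of a function on space-time. -/
noncomputable def timeDeriv (φ : Rd d × ℝ → ℝ) (z : Rd d × ℝ) : ℝ :=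
  deriv (fun s => φ (z.1, s)) z.2

/-- Spatial gradient of a function on space-time. -/
noncomputable def spaceGrad (φ : Rd d × ℝ → ℝ) (z : Rd d × ℝ) : Rd d :=
  gradient (fun y => φ (y, z.2)) z.1

theorem hasDerivAt_timeDeriv {φ : Rd d × ℝ → ℝ} (hφ : ContDiff ℝ 1 φ) (z : Rd d × ℝ) :
    HasDerivAt (fun s => φ (z.1, s)) (timeDeriv φ z) z.2 := by
  have : Differentiable ℝ (fun s => φ (z.1, s)) := by
    have := hφ.differentiable one_ne_zero
    fun_prop
  exact (this z.2).hasDerivAt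

theorem hasGradientAt_spaceGrad {φ : Rd d × ℝ → ℝ} (hφ : ContDiff ℝ 1 φ) (z : Rd d × ℝ) :
    HasGradientAt (fun y => φ (y, z.2)) (spaceGrad φ z) z.1 := by
  have : Differentiable ℝ (fun y => φ (y, z.2)) := by
    have := hφ.differentiable one_ne_zero
    fun_prop
  exact (this z.1).hasGradientAt

theorem continuous_timeDeriv {φ : Rd d × ℝ → ℝ} (hφ : ContDiff ℝ 1 φ) :
    Continuous (timeDeriv φ) := by
  have h : timeDeriv φ = fun z => fderiv ℝ φ z ((0 : Rd d), (1 : ℝ)) := by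
    funext z
    have h1 := (hφ.differentiable one_ne_zero z).hasFDerivAt
    have h2 : HasDerivAt (fun s : ℝ => (z.1, s)) ((0 : Rd d), (1 : ℝ)) z.2 :=
      (hasDerivAt_const z.2 z.1).prodMk (hasDerivAt_id z.2)
    exact (h1.comp_hasDerivAt z.2 h2).deriv
  rw [h]
  exact (hφ.continuous_fderiv one_ne_zero).clm_apply continuous_const

theorem continuous_spaceGrad {φ : Rd d × ℝ → ℝ} (hφ : ContDiff ℝ 1 φ) :
    Continuous (spaceGrad φ) := by
  have h : spaceGrad φ = fun z => (InnerProductSpace.toDual ℝ (Rd d)).symm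
      ((fderiv ℝ φ z).comp (ContinuousLinearMap.inl ℝ (Rd d) ℝ)) := by
    funext z
    have h1 := (hφ.differentiable one_ne_zero z).hasFDerivAt
    have h2 : HasFDerivAt (fun y : Rd d => (y, z.2)) (ContinuousLinearMap.inl ℝ (Rd d) ℝ) z.1 :=
      hasFDerivAt_prodMk_left z.1 z.2
    have h3 := h1.comp z.1 h2
    rw [spaceGrad, gradient]
    congr 1
    exact h3.fderiv
  rw [h]
  exact (LinearIsometryEquiv.continuous _).comp
    ((hφ.continuous_fderiv one_ne_zero).clm_comp continuous_const)

/-- Perturbed test function argument: if `u ε - φ` has, for arbitrarily small `ε`, an interior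
maximum in a small ball, then `φ` satisfies the effective inequality up to an error, with the
effective value of any slope close to that of `φ`. -/
theorem timeDeriv_add_le_of_frequently {H : Rd d → Rd d → ℝ} (hH : IsAdmissible H) {M η : ℝ}
    (hM : 0 ≤ M) (hη : 0 < η) :
    ∃ s > 0, ∀ (q : Rd d) (h : ℝ), HomogenizesAt H q h →
      ∀ (φ : Rd d × ℝ → ℝ) (z₀ : Rd d × ℝ) (r c gap : ℝ) (u : ℝ → Rd d × ℝ → ℝ),
      ContDiff ℝ 1 φ → 0 < r → 0 < gap → |timeDeriv φ z₀| ≤ M ∨ |h| ≤ M →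
      (∀ z ∈ Metric.ball z₀ r, ‖spaceGrad φ z - q‖ ≤ s ∧ |timeDeriv φ z - timeDeriv φ z₀| ≤ η) →
      (∀ᶠ ε in 𝓝[>] (0 : ℝ), ContinuousOn (u ε) (Metric.closedBall z₀ r)) →
      (∀ᶠ ε in 𝓝[>] (0 : ℝ),
        IsViscositySubOn (fun p x => H p (ε⁻¹ • x)) η (Metric.ball z₀ r) (u ε)) →
      (∃ᶠ ε in 𝓝[>] (0 : ℝ), (∀ z ∈ Metric.sphere z₀ r, u ε z - φ z ≤ c - gap) ∧
        ∃ z ∈ Metric.ball z₀ r, c ≤ u ε z - φ z) →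
      timeDeriv φ z₀ + h ≤ 4 * η := by
  -- `R` is where coercivity beats every value that the two viscosity inequalities allow; the
  -- modulus is taken on the ball of radius `R + 3` to contain both slopes.
  obtain ⟨R, hR⟩ := hH.coercive (M + 2 * η)
  obtain ⟨s, hs, hunif⟩ := hH.unif (R + 3) η hη
  refine ⟨min s 1, by positivity, ?_⟩
  intro q h ⟨v, hv, hvl⟩ φ z₀ r c gap u hφ hr hgap hMor hclose hcont hsub hfreq
  by_contra! hcon
  have hδ : 0 < min (gap / 4) η := by positivity
  have hev := hvl (‖z₀.1‖ + 2 * r) (by positivity) _ hδ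
  obtain ⟨ε, ⟨hsph, z₁, hz₁, hcen⟩, hε, hcε, hsε, hvε⟩ :=
    (hfreq.and_eventually (eventually_mem_nhdsWithin.and (hcont.and (hsub.and hev)))).exists
  have hε : 0 < ε := hε
  -- The tolerance scales with `ε` so that `ε⁻¹ • x` and `y` are within `s` of each other in the
  -- fast variable.
  obtain ⟨N, hN, x, t, y, hball, htol, hvy, hmax, hmin⟩ := exists_doubling_max
    (tol := ε * min s 1) (h := h) (δ := min (gap / 4) η) hr hε hcε hφ.continuous (hv ε hε).continuous
    (fun y hy => hvε y (by
      rw [norm_smul, Real.norm_of_nonneg hε.le] at hy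
      rw [le_div_iff₀ hε]; linarith))
    (by linarith [min_le_left (gap / 4) η]) hsph hz₁ hcen (by positivity)
  set Q := N • (2 : ℝ) • (x - ε • y) with hQ
  have hψ : ContDiff ℝ 1 fun z : Rd d × ℝ => φ z + N * ‖z.1 - ε • y‖ ^ 2 := by
    have h2 : ContDiff ℝ 1 fun z : Rd d × ℝ => ‖z.1 - ε • y‖ ^ 2 :=
      (contDiff_fst.sub contDiff_const).norm_sq ℝ
    fun_prop
  have key₁ := hsε _ x t hball hψ hmax
  have hg₁ : HasGradientAt (fun a => φ (a, t) + N * ‖a - ε • y‖ ^ 2) (spaceGrad φ (x, t) + Q) x :=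
    (hasGradientAt_spaceGrad hφ (x, t)).add_gradient
      ((hasGradientAt_norm_sub_sq (ε • y) x).const_mul_gradient N)
  have hd₁ : HasDerivAt (fun a => φ (x, a) + N * ‖x - ε • y‖ ^ 2) (timeDeriv φ (x, t)) t :=
    (hasDerivAt_timeDeriv hφ (x, t)).add_const _
  simp only at key₁
  rw [hg₁.gradient, hd₁.deriv] at key₁
  have hχ : ContDiff ℝ 1 fun w : Rd d => (-(N / ε)) * ‖ε • w - x‖ ^ 2 := by
    have h2 : ContDiff ℝ 1 fun w : Rd d => ‖ε • w - x‖ ^ 2 :=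
      ((contDiff_id.const_smul ε).sub contDiff_const).norm_sq ℝ
    fun_prop
  have key₂ := (hv ε hε).super _ y hχ hmin
  have hg₂ : HasGradientAt (fun w => (-(N / ε)) * ‖ε • w - x‖ ^ 2) Q y := by
    have h1 := ((hasGradientAt_norm_sub_sq x (ε • y)).comp_smul ε y).const_mul_gradient (-(N / ε))
    have h2 : (-(N / ε)) • ε • (2 : ℝ) • (ε • y - x) = Q := by
      rw [smul_smul, hQ, neg_mul, div_mul_cancel₀ _ hε.ne', neg_smul, ← smul_neg, ← smul_neg,
        neg_sub]
    rwa [h2] at h1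
  rw [hg₂.gradient] at key₂
  obtain ⟨hcl1, hcl2⟩ := hclose _ hball
  have hcl2 := abs_le.1 hcl2
  have hvy := abs_le.1 hvy
  have hδη : min (gap / 4) η ≤ η := min_le_right _ _
  have hxy : ‖ε⁻¹ • x - y‖ ≤ s := by
    have h1 : ε⁻¹ • x - y = ε⁻¹ • (x - ε • y) := by rw [smul_sub, inv_smul_smul₀ hε.ne']
    rw [h1, norm_smul, norm_inv, Real.norm_of_nonneg hε.le, inv_mul_le_iff₀ hε]
    exact htol.trans (by gcongr; exact min_le_left _ _)
  have hdiff : (spaceGrad φ (x, t) + Q) - (q + Q) = spaceGrad φ (x, t) - q := by abel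
  have hdn : ‖(spaceGrad φ (x, t) + Q) - (q + Q)‖ ≤ min s 1 := by rwa [hdiff]
  -- The subsolution inequality bounds `H` above at one slope, the corrector bounds it below at the
  -- other. A bound on either `timeDeriv φ z₀` or `h` suffices, because `hcon` transfers it to the
  -- other in the direction needed.
  have hsmall : ‖q + Q‖ ≤ R + 2 := by
    by_contra! hbig
    have h1 : ‖q + Q‖ ≤ ‖spaceGrad φ (x, t) + Q‖ + min s 1 := by
      linarith [norm_sub_norm_le (q + Q) (spaceGrad φ (x, t) + Q),
        norm_sub_rev (q + Q) (spaceGrad φ (x, t) + Q)]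
    refine not_sign_change hH.continuous (by positivity : 0 ≤ M + 2 * η) hR
      (P := spaceGrad φ (x, t) + Q) (Q := q + Q) (x := ε⁻¹ • x) (y := y) ?_ ?_ ?_
    · rw [norm_sub_rev]
      linarith [min_le_right s 1]
    · rcases hMor with h2 | h2
      · linarith [abs_le.1 h2]
      · linarith [abs_le.1 h2]
    · rcases hMor with h2 | h2
      · linarith [abs_le.1 h2]
      · linarith [abs_le.1 h2]
  have hsmall' : ‖spaceGrad φ (x, t) + Q‖ ≤ R + 3 := by
    linarith [norm_sub_norm_le (spaceGrad φ (x, t) + Q) (q + Q), min_le_right s 1]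
  -- The four errors `η` come from the approximate subsolution, the variation of the time
  -- derivative, the corrector and the modulus of `H`.
  have := abs_le.1 (hunif _ _ hsmall' (by linarith) (ε⁻¹ • x) y
    (hdn.trans (min_le_left _ _)) hxy)
  linarith

end PerturbedTest

/-! ### Continuity of the effective Hamiltonian. -/

section EffectiveHamiltonian

variable {d : ℕ}

/-- The function `⟨p, x⟩ + ε v(x/ε) - h t` built from a subsolution `v` of the auxiliary problem is
an approximate subsolution of the evolution problem wherever `ε v(x/ε)` is close to `-h`. -/
theorem IsAuxiliarySolution.isViscositySubOn {H : Rd d → Rd d → ℝ} {ε : ℝ} (hε : 0 < ε)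
    {p : Rd d} {v : Rd d → ℝ} (hv : IsAuxiliarySolution H ε p v) {h η : ℝ} {S : Set (Rd d × ℝ)}
    (hS : ∀ z ∈ S, |ε * v (ε⁻¹ • z.1) + h| ≤ η) :
    IsViscositySubOn (fun p x => H p (ε⁻¹ • x)) η S
      (fun z => inner ℝ p z.1 + ε * v (ε⁻¹ • z.1) - h * z.2) := by
  intro ψ x t hxt hψ hmax
  have ht : timeDeriv ψ (x, t) = -h := by
    have h1 : HasDerivAt (fun s => inner ℝ p x + ε * v (ε⁻¹ • x) - h * s - ψ (x, s))
        (-(h * 1) - timeDeriv ψ (x, t)) t :=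
      (((hasDerivAt_id t).const_mul h).const_sub _).sub (hasDerivAt_timeDeriv hψ (x, t))
    have h2 : IsLocalMax (fun s => inner ℝ p x + ε * v (ε⁻¹ • x) - h * s - ψ (x, s)) t :=
      hmax.comp_tendsto (g := fun s : ℝ => (x, s)) (Continuous.tendsto (by fun_prop) t)
    linarith [h2.hasDerivAt_eq_zero h1]
  set χ : Rd d → ℝ := fun y => ε⁻¹ * (ψ (ε • y, t) + -inner ℝ p (ε • y)) with hχ
  have hχd : ContDiff ℝ 1 χ := by
    have h1 : ContDiff ℝ 1 fun y : Rd d => ψ (ε • y, t) := by fun_prop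
    exact contDiff_const.mul
      (h1.add (contDiff_const.inner ℝ (contDiff_id.const_smul ε)).neg)
  have hg : HasGradientAt χ (spaceGrad ψ (x, t) - p) (ε⁻¹ • x) := by
    have e : ε • ε⁻¹ • x = x := smul_inv_smul₀ hε.ne' x
    have h1 : HasGradientAt (fun y => ψ (y, t) + -inner ℝ p y) (spaceGrad ψ (x, t) + -p)
        (ε • ε⁻¹ • x) := by
      rw [e]
      exact (hasGradientAt_spaceGrad hψ (x, t)).add_gradient
        (hasGradientAt_inner_left p x).neg_gradient
    have h2 := (h1.comp_smul ε (ε⁻¹ • x)).const_mul_gradient ε⁻¹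
    rwa [inv_smul_smul₀ hε.ne', ← sub_eq_add_neg] at h2
  have hm : IsLocalMax (fun y => v y - χ y) (ε⁻¹ • x) := by
    have htend : Tendsto (fun y : Rd d => (ε • y, t)) (𝓝 (ε⁻¹ • x)) (𝓝 (x, t)) := by
      have := Continuous.tendsto (f := fun y : Rd d => (ε • y, t)) (by fun_prop) (ε⁻¹ • x)
      rwa [smul_inv_smul₀ hε.ne'] at this
    filter_upwards [htend.eventually hmax] with y hy
    simp only [hχ, inv_smul_smul₀ hε.ne', smul_inv_smul₀ hε.ne'] at hy ⊢
    refine le_of_mul_le_mul_left ?_ hε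
    have e1 : ∀ a b : ℝ, ε * (a - ε⁻¹ * b) = ε * a - b := fun a b => by field_simp
    rw [e1, e1]
    linarith
  have key := hv.sub χ _ hχd hm
  rw [hg.gradient, add_sub_cancel] at key
  have := abs_le.1 (hS _ hxt)
  change timeDeriv ψ (x, t) + H (spaceGrad ψ (x, t)) (ε⁻¹ • x) ≤ η
  simp only at this
  linarith

/-- Space-time carries the sup metric, so one of the two coordinates realizes the distance. This
makes a quadratic perturbation a strict penalty on spheres. -/
theorem sq_le_norm_sq_add_sq {r : ℝ} {z₀ z : Rd d × ℝ} (hz : dist z z₀ = r) :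
    r ^ 2 ≤ ‖z.1 - z₀.1‖ ^ 2 + (z.2 - z₀.2) ^ 2 := by
  rw [Prod.dist_eq, dist_eq_norm, Real.dist_eq] at hz
  rcases max_choice ‖z.1 - z₀.1‖ |z.2 - z₀.2| with h | h <;> rw [h] at hz
  · rw [hz]; nlinarith [sq_nonneg (z.2 - z₀.2)]
  · rw [← sq_abs (z.2 - z₀.2), hz]; nlinarith [norm_nonneg (z.1 - z₀.1)]

/-- The corrected affine function of slope `p` nearly solves the oscillating equation and converges
to an affine function moving with speed `-h`. Testing it with the correctors of a nearby slope `q`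
yields the effective inequality with `k`. -/
theorem exists_sub_le_of_homogenizesAt {H : Rd d → Rd d → ℝ} (hH : IsAdmissible H) {M η : ℝ}
    (hM : 0 ≤ M) (hη : 0 < η) :
    ∃ κ > 0, ∀ p h q k, HomogenizesAt H p h → HomogenizesAt H q k → ‖p - q‖ ≤ κ →
      |h| ≤ M ∨ |k| ≤ M → k - h ≤ 4 * η := by
  obtain ⟨s, hs, key⟩ := timeDeriv_add_le_of_frequently hH hM hη
  refine ⟨s / 2, by positivity, fun p h q k ⟨v, hv, hvl⟩ hq hpq hMor => ?_⟩
  set φ : Rd d × ℝ → ℝ := fun z => inner ℝ p z.1 + -(h * z.2) + (‖z.1 - 0‖ ^ 2 + 1 * (z.2 - 0) ^ 2)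
    with hφdef
  have hφ : ContDiff ℝ 1 φ := by
    have h1 : ContDiff ℝ 1 fun z : Rd d × ℝ => (inner ℝ p z.1 : ℝ) :=
      contDiff_const.inner ℝ contDiff_fst
    have h2 : ContDiff ℝ 1 fun z : Rd d × ℝ => ‖z.1 - 0‖ ^ 2 :=
      (contDiff_fst.sub contDiff_const).norm_sq ℝ
    have h3 : ContDiff ℝ 1 fun z : Rd d × ℝ => -(h * z.2) := by fun_prop
    have h4 : ContDiff ℝ 1 fun z : Rd d × ℝ => 1 * (z.2 - 0) ^ 2 := by fun_prop
    exact (h1.add h3).add (h2.add h4)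
  have hg : ∀ z, spaceGrad φ z = p + (2 : ℝ) • z.1 := fun z => by
    have h1 := ((hasGradientAt_inner_left p z.1).add_gradient
      (hasGradientAt_const z.1 (-(h * z.2)))).add_gradient
      ((hasGradientAt_norm_sub_sq 0 z.1).add_gradient
      (hasGradientAt_const z.1 (1 * (z.2 - 0) ^ 2)))
    refine h1.gradient.trans ?_
    rw [add_zero, add_zero, sub_zero]
  have ht : ∀ z, timeDeriv φ z = -h + 2 * z.2 := fun z => by
    have h1 := ((((hasDerivAt_id z.2).const_mul h).neg).const_add (inner ℝ p z.1)).add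
      ((hasDerivAt_const_mul_sub_sq 1 0 z.2).const_add (‖z.1 - 0‖ ^ 2))
    rw [timeDeriv]
    refine h1.deriv.trans (by ring)
  set r := min (s / 4) (η / 2) with hr
  have hr0 : 0 < r := by positivity
  set u : ℝ → Rd d × ℝ → ℝ := fun ε z => inner ℝ p z.1 + ε * v ε (ε⁻¹ • z.1) - h * z.2 with hu
  have hδ : 0 < min (r ^ 2 / 8) η := by positivity
  have hev : ∀ᶠ ε in 𝓝[>] (0 : ℝ), ∀ z ∈ Metric.closedBall (0 : Rd d × ℝ) r,
      |ε * v ε (ε⁻¹ • z.1) + h| ≤ min (r ^ 2 / 8) η := by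
    filter_upwards [hvl r hr0 _ hδ, eventually_mem_nhdsWithin] with ε h1 hε z hz
    refine h1 _ ?_
    have hε : 0 < ε := hε
    rw [norm_smul, norm_inv, Real.norm_of_nonneg hε.le, inv_mul_eq_div]
    gcongr
    exact (norm_fst_le z).trans (mem_closedBall_zero_iff.1 hz)
  -- Around `0`, `u - φ` is within `r ^ 2 / 8` of `-h` minus the quadratic term, which is at least
  -- `r ^ 2` on the sphere.
  have hfin := key q k hq φ 0 r (-h - r ^ 2 / 8) (r ^ 2 / 2) u hφ hr0 (by positivity)
    (by rw [ht]; simpa using hMor) ?_ ?_ ?_ ?_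
  · rw [ht] at hfin
    simp at hfin
    linarith
  · intro z hz
    rw [mem_ball_zero_iff] at hz
    have h1 : ‖z.1‖ < r := (norm_fst_le z).trans_lt hz
    have h2 : ‖z.2‖ < r := (norm_snd_le z).trans_lt hz
    have h3 : r ≤ s / 4 := min_le_left _ _
    have h4 : r ≤ η / 2 := min_le_right _ _
    constructor
    · rw [hg, add_sub_right_comm]
      refine (norm_add_le _ _).trans ?_
      rw [norm_smul, Real.norm_of_nonneg zero_le_two]
      linarith
    · rw [ht, ht]
      have : -h + 2 * z.2 - (-h + 2 * (0 : Rd d × ℝ).2) = 2 * z.2 := by simp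
      rw [this, abs_mul, abs_two]
      rw [Real.norm_eq_abs] at h2
      linarith
  · filter_upwards [eventually_mem_nhdsWithin] with ε hε
    have := (hv ε hε).continuous
    exact Continuous.continuousOn (by fun_prop)
  · filter_upwards [hev, eventually_mem_nhdsWithin] with ε h1 hε
    exact (hv ε hε).isViscositySubOn hε fun z hz =>
      (h1 z (Metric.ball_subset_closedBall hz)).trans (min_le_right _ _)
  · refine Eventually.frequently ?_
    filter_upwards [hev] with ε h1
    have h2 : min (r ^ 2 / 8) η ≤ r ^ 2 / 8 := min_le_left _ _
    refine ⟨fun z hz => ?_, 0, Metric.mem_ball_self hr0, ?_⟩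
    · have h3 := abs_le.1 (h1 z (Metric.sphere_subset_closedBall hz))
      have h4 := sq_le_norm_sq_add_sq (Metric.mem_sphere.1 hz)
      simp only [Prod.fst_zero, Prod.snd_zero] at h4
      simp only [hu, hφdef]
      linarith
    · have h3 := abs_le.1 (h1 0 (Metric.mem_closedBall_self hr0.le))
      simp only [hu, hφdef]
      simp only [Prod.fst_zero, Prod.snd_zero, sub_zero, norm_zero] at h3 ⊢
      linarith

/-- The one-sided estimate is applied both ways; since it needs a bound on only one effective value,
none is required for `k`. -/
theorem HomogenizesAt.exists_abs_sub_le {H : Rd d → Rd d → ℝ} (hH : IsAdmissible H) {p : Rd d}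
    {h : ℝ} (hp : HomogenizesAt H p h) {η : ℝ} (hη : 0 < η) :
    ∃ κ > 0, ∀ q k, HomogenizesAt H q k → ‖q - p‖ ≤ κ → |k - h| ≤ η := by
  obtain ⟨κ, hκ, key⟩ := exists_sub_le_of_homogenizesAt hH (abs_nonneg h) (η := η / 4) (by positivity)
  refine ⟨κ, hκ, fun q k hq hqp => abs_le.2 ⟨?_, ?_⟩⟩
  · linarith [key q k p h hq hp hqp (Or.inr le_rfl)]
  · linarith [key p h q k hp hq (by rwa [norm_sub_rev]) (Or.inl le_rfl)]

end EffectiveHamiltonian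

/-! ### Half-relaxed limits. -/

section RelaxedLimit

variable {d : ℕ}

/-- `U` is the upper half-relaxed limit of the functions `u ε` as `ε → 0+`. -/
structure IsUpperRelaxedLimit (u : ℝ → Rd d × ℝ → ℝ) (U : Rd d × ℝ → ℝ) : Prop where
  eventually_lt : ∀ z ∈ univ ×ˢ Ici (0 : ℝ), ∀ c > U z,
    ∀ᶠ w in 𝓝[>] (0 : ℝ) ×ˢ 𝓝[univ ×ˢ Ici (0 : ℝ)] z, u w.1 w.2 < c
  frequently_lt : ∀ z ∈ univ ×ˢ Ici (0 : ℝ), ∀ c < U z,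
    ∃ᶠ w in 𝓝[>] (0 : ℝ) ×ˢ 𝓝[univ ×ˢ Ici (0 : ℝ)] z, c < u w.1 w.2

theorem neBot_relaxed {z : Rd d × ℝ} (hz : z ∈ univ ×ˢ Ici (0 : ℝ)) :
    (𝓝[>] (0 : ℝ) ×ˢ 𝓝[univ ×ˢ Ici (0 : ℝ)] z).NeBot := by
  have : (𝓝[univ ×ˢ Ici (0 : ℝ)] z).NeBot := mem_closure_iff_nhdsWithin_neBot.1 (subset_closure hz)
  infer_instance

theorem eventually_relaxed_mem (z : Rd d × ℝ) :
    ∀ᶠ w in 𝓝[>] (0 : ℝ) ×ˢ 𝓝[univ ×ˢ Ici (0 : ℝ)] z, 0 < w.1 ∧ 0 ≤ w.2.2 := by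
  filter_upwards [prod_mem_prod (self_mem_nhdsWithin (s := Ioi (0 : ℝ)))
    (self_mem_nhdsWithin (s := univ ×ˢ Ici (0 : ℝ)) (a := z))] with w hw
  exact ⟨hw.1, hw.2.2⟩

theorem exists_isUpperRelaxedLimit {u : ℝ → Rd d × ℝ → ℝ}
    (hb : ∀ T : ℝ, ∃ B : ℝ, ∀ ε > 0, ∀ x, ∀ t ∈ Icc 0 T, |u ε (x, t)| ≤ B) :
    ∃ U, IsUpperRelaxedLimit u U := by
  have hbz : ∀ z : Rd d × ℝ, ∃ B, ∀ᶠ w in 𝓝[>] (0 : ℝ) ×ˢ 𝓝[univ ×ˢ Ici (0 : ℝ)] z,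
      |u w.1 w.2| ≤ B := fun z => by
    obtain ⟨B, hB⟩ := hb (z.2 + 1)
    refine ⟨B, ?_⟩
    have h1 : ∀ᶠ w in 𝓝[>] (0 : ℝ) ×ˢ 𝓝[univ ×ˢ Ici (0 : ℝ)] z, w.2.2 < z.2 + 1 := by
      have h2 : Tendsto (fun w : ℝ × (Rd d × ℝ) => w.2.2)
          (𝓝[>] (0 : ℝ) ×ˢ 𝓝[univ ×ˢ Ici (0 : ℝ)] z) (𝓝 z.2) :=
        (continuous_snd.tendsto z).comp (tendsto_snd.mono_right nhdsWithin_le_nhds)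
      exact h2.eventually_lt_const (by linarith)
    filter_upwards [eventually_relaxed_mem z, h1] with w hw hw1
    exact hB w.1 hw.1 w.2.1 w.2.2 ⟨hw.2, hw1.le⟩
  refine ⟨fun z => limsup (fun w : ℝ × (Rd d × ℝ) => u w.1 w.2)
    (𝓝[>] (0 : ℝ) ×ˢ 𝓝[univ ×ˢ Ici (0 : ℝ)] z), fun z hz c hc => ?_, fun z hz c hc => ?_⟩
  · obtain ⟨B, hB⟩ := hbz z
    exact eventually_lt_of_limsup_lt hc
      (isBoundedUnder_of_eventually_le (hB.mono fun w hw => (abs_le.1 hw).2))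
  · obtain ⟨B, hB⟩ := hbz z
    have := neBot_relaxed hz
    exact frequently_lt_of_lt_limsup
      (isBoundedUnder_of_eventually_ge
        (hB.mono fun w hw => (abs_le.1 hw).1)).isCoboundedUnder_le hc

namespace IsUpperRelaxedLimit

variable {u : ℝ → Rd d × ℝ → ℝ} {U : Rd d × ℝ → ℝ}

theorem upperSemicontinuousOn (h : IsUpperRelaxedLimit u U) :
    UpperSemicontinuousOn U (univ ×ˢ Ici 0) := by
  intro z hz c hc
  obtain ⟨c', h1, h2⟩ := exists_between hc
  obtain ⟨p, hp, q, hq, hpq⟩ := eventually_prod_iff.1 (h.eventually_lt z hz c' h1)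
  filter_upwards [eventually_eventually_nhdsWithin.2 hq, self_mem_nhdsWithin] with w hw hws
  by_contra! hcon
  obtain ⟨y, hy1, hy2⟩ := ((h.frequently_lt w hws c' (h2.trans_le hcon)).and_eventually
    (hp.prod_mk hw)).exists
  exact absurd (hpq hy2.1 hy2.2) (not_lt.2 hy1.le)

theorem le_of_forall_le (h : IsUpperRelaxedLimit u U) {g : Rd d × ℝ → ℝ} (hg : Continuous g)
    (hle : ∀ ε > 0, ∀ x, ∀ t ≥ 0, u ε (x, t) ≤ g (x, t)) (x : Rd d) {t : ℝ} (ht : 0 ≤ t) :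
    U (x, t) ≤ g (x, t) := by
  by_contra! hcon
  obtain ⟨c, h1, h2⟩ := exists_between hcon
  have hev : ∀ᶠ w in 𝓝[>] (0 : ℝ) ×ˢ 𝓝[univ ×ˢ Ici (0 : ℝ)] (x, t), g w.2 < c :=
    ((hg.tendsto (x, t)).comp (tendsto_snd.mono_right nhdsWithin_le_nhds)).eventually_lt_const h1
  obtain ⟨w, hw, hw1, hw2⟩ := ((h.frequently_lt (x, t) ⟨trivial, ht⟩ c h2).and_eventually
    (hev.and (eventually_relaxed_mem _))).exists
  have := hle w.1 hw2.1 w.2.1 w.2.2 hw2.2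
  simp only [Prod.mk.eta] at this
  linarith

theorem add_nonneg {W : Rd d × ℝ → ℝ} (h : IsUpperRelaxedLimit u U)
    (h' : IsUpperRelaxedLimit (fun ε z => - u ε z) W) {z : Rd d × ℝ}
    (hz : z ∈ univ ×ˢ Ici (0 : ℝ)) : 0 ≤ U z + W z := by
  by_contra! hcon
  have := neBot_relaxed hz
  obtain ⟨w, h1, h2⟩ := ((h.eventually_lt z hz (U z - (U z + W z) / 2) (by linarith)).and
    (h'.eventually_lt z hz (W z - (U z + W z) / 2) (by linarith))).exists
  linarith

/-- The upper half-relaxed limit of solutions of the oscillating problems is a subsolution of the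
effective problem. -/
theorem isViscositySubOn {H : Rd d → Rd d → ℝ} (hH : IsAdmissible H) {Hbar : Rd d → ℝ}
    (hbar : Continuous Hbar) {D : Set (Rd d)} (hD : Dense D)
    (hhom : ∀ p ∈ D, HomogenizesAt H p (Hbar p))
    (hcont : ∀ ε > 0, ContinuousOn (u ε) (univ ×ˢ Ici 0))
    (hsub : ∀ ε > 0, IsViscositySubOn (fun p x => H p (ε⁻¹ • x)) 0 (univ ×ˢ Ioi 0) (u ε))
    (hU : IsUpperRelaxedLimit u U) :
    IsViscositySubOn (fun p _ => Hbar p) 0 (univ ×ˢ Ioi 0) U := by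
  intro φ x₀ t₀ ht₀ hφ hmax
  replace ht₀ : 0 < t₀ := ht₀.2
  refine le_of_forall_pos_le_add fun η' hη' => ?_
  -- Four `η` go to the perturbed test function estimate and one to replacing the slope of `φ` by a
  -- slope in `D`.
  obtain ⟨η, hη, hηη⟩ : ∃ η > 0, 5 * η = η' := ⟨η' / 5, by positivity, by ring⟩
  set z₀ : Rd d × ℝ := (x₀, t₀) with hz₀
  -- Makes the maximum strict without changing the first derivatives at `z₀`.
  set Q : Rd d × ℝ → ℝ := fun z => ‖z.1 - x₀‖ ^ 2 + 1 * (z.2 - t₀) ^ 2 with hQdef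
  have hQ : ContDiff ℝ 1 Q := by
    have h2 : ContDiff ℝ 1 fun z : Rd d × ℝ => ‖z.1 - x₀‖ ^ 2 :=
      (contDiff_fst.sub contDiff_const).norm_sq ℝ
    fun_prop
  have hQ0 : Q z₀ = 0 := by simp [hQdef, hz₀]
  have hφQ : ContDiff ℝ 1 fun z => φ z + Q z := hφ.add hQ
  have hg : spaceGrad (fun z => φ z + Q z) z₀ = spaceGrad φ z₀ := by
    have h1 := (hasGradientAt_spaceGrad hφ z₀).add_gradient
      ((hasGradientAt_norm_sub_sq x₀ x₀).add_gradient
      (hasGradientAt_const x₀ (1 * (t₀ - t₀) ^ 2)))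
    refine h1.gradient.trans ?_
    rw [sub_self, smul_zero, add_zero, add_zero]
  have htd : timeDeriv (fun z => φ z + Q z) z₀ = timeDeriv φ z₀ := by
    have h1 := (hasDerivAt_timeDeriv hφ z₀).add
      ((hasDerivAt_const_mul_sub_sq 1 t₀ t₀).const_add (‖x₀ - x₀‖ ^ 2))
    refine h1.deriv.trans (by ring)
  obtain ⟨s, hs, key⟩ := timeDeriv_add_le_of_frequently hH (abs_nonneg (timeDeriv φ z₀)) hη
  obtain ⟨q, ⟨hq1, hq2⟩, hqD⟩ : ∃ q, (‖spaceGrad φ z₀ - q‖ < s ∧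
      Hbar (spaceGrad φ z₀) < Hbar q + η) ∧ q ∈ D := by
    have hopen : IsOpen {q | ‖spaceGrad φ z₀ - q‖ < s ∧ Hbar (spaceGrad φ z₀) < Hbar q + η} := by
      refine IsOpen.and ?_ ?_
      · exact isOpen_lt (by fun_prop) continuous_const
      · exact isOpen_lt (by fun_prop) (by fun_prop)
    obtain ⟨q, hq⟩ := hD.inter_open_nonempty _ hopen ⟨spaceGrad φ z₀, by simpa using ⟨hs, hη⟩⟩
    exact ⟨q, hq⟩
  have hnear : ∀ᶠ z in 𝓝 z₀, (‖spaceGrad (fun z => φ z + Q z) z - q‖ < s ∧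
      |timeDeriv (fun z => φ z + Q z) z - timeDeriv (fun z => φ z + Q z) z₀| < η) ∧
      U z - φ z ≤ U z₀ - φ z₀ ∧ 0 < z.2 := by
    refine (Eventually.and ?_ ?_).and (hmax.and ?_)
    · have hc := continuous_spaceGrad hφQ
      refine (isOpen_lt (by fun_prop) continuous_const).mem_nhds ?_
      simpa only [hg, mem_ofPred_eq] using hq1
    · have hc := continuous_timeDeriv hφQ
      refine (isOpen_lt (by fun_prop) continuous_const).mem_nhds ?_
      simpa using hη
    · exact (isOpen_lt continuous_const continuous_snd).mem_nhds ht₀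
  obtain ⟨r, hr, hball⟩ := Metric.nhds_basis_closedBall.eventually_iff.1 hnear
  have hpos : ∀ z ∈ Metric.closedBall z₀ r, z ∈ univ ×ˢ Ioi (0 : ℝ) := fun z hz =>
    ⟨trivial, (hball hz).2.2⟩
  have hnhds : ∀ z ∈ Metric.closedBall z₀ r, 𝓝[univ ×ˢ Ici (0 : ℝ)] z = 𝓝 z := fun z hz =>
    nhdsWithin_eq_nhds.2 (mem_of_superset
      ((isOpen_univ.prod isOpen_Ioi).mem_nhds (hpos z hz)) (prod_mono subset_rfl Ioi_subset_Ici_self))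
  have hfin := key q (Hbar q) (hhom q hqD) (fun z => φ z + Q z) z₀ r
    (U z₀ - φ z₀ - r ^ 2 / 4) (r ^ 2 / 4) u hφQ hr (by positivity) (Or.inl (by rw [htd])) ?_ ?_ ?_ ?_
  · rw [htd] at hfin
    change timeDeriv φ z₀ + Hbar (spaceGrad φ z₀) ≤ 0 + η'
    linarith
  · intro z hz
    have := (hball (Metric.ball_subset_closedBall hz)).1
    exact ⟨this.1.le, this.2.le⟩
  · filter_upwards [eventually_mem_nhdsWithin] with ε hε
    exact (hcont ε hε).mono fun z hz => ⟨trivial, (mem_Ioi.1 (hpos z hz).2).le⟩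
  · filter_upwards [eventually_mem_nhdsWithin] with ε hε ψ x t hxt hψ hm
    exact (hsub ε hε ψ x t (hpos _ (Metric.ball_subset_closedBall hxt)) hψ hm).trans hη.le
  · have hcφ : Continuous fun z => φ z + Q z := hφQ.continuous
    have hsph : ∀ᶠ ε in 𝓝 (0 : ℝ), ∀ z ∈ Metric.sphere z₀ r,
        0 < ε → u ε z - (φ z + Q z) ≤ U z₀ - φ z₀ - r ^ 2 / 2 := by
      -- The relaxed limit controls `u ε` near each point of the sphere with a loss of `3 / 4 * r ^
      -- 2`; compactness makes this uniform, and a quarter is spent on the variation of `φ + Q`.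
      refine (isCompact_sphere z₀ r).eventually_forall_of_forall_eventually fun z hz => ?_
      have hzb := Metric.sphere_subset_closedBall hz
      have h1 : r ^ 2 ≤ Q z := by
        simpa [hQdef] using sq_le_norm_sq_add_sq (Metric.mem_sphere.1 hz)
      have h2 := (hball hzb).2.1
      have h3 := hU.eventually_lt z ⟨trivial, (hball hzb).2.2.le⟩
        (φ z + Q z + (U z₀ - φ z₀) - 3 / 4 * r ^ 2) (by nlinarith)
      rw [hnhds z hzb, ← nhdsWithin_univ z, ← nhdsWithin_prod_eq, eventually_nhdsWithin_iff] at h3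
      have h4 : ∀ᶠ w : ℝ × (Rd d × ℝ) in 𝓝 ((0 : ℝ), z), φ z + Q z - r ^ 2 / 4 < φ w.2 + Q w.2 :=
        ((hcφ.comp continuous_snd).tendsto ((0 : ℝ), z)).eventually_const_lt
          (by
            have : 0 < r ^ 2 := by positivity
            simp only [Function.comp]
            linarith)
      filter_upwards [h3, h4] with w h5 h6 hw
      have := h5 ⟨hw, trivial⟩
      linarith
    have hcen : ∃ᶠ ε in 𝓝[>] (0 : ℝ), ∃ z ∈ Metric.ball z₀ r,
        U z₀ - φ z₀ - r ^ 2 / 4 ≤ u ε z - (φ z + Q z) := by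
      have hz₀b : z₀ ∈ Metric.closedBall z₀ r := Metric.mem_closedBall_self hr.le
      have hr2 : 0 < r ^ 2 := by positivity
      have h1 := hU.frequently_lt z₀ ⟨trivial, ht₀.le⟩ (U z₀ - r ^ 2 / 8) (by linarith)
      rw [hnhds z₀ hz₀b] at h1
      intro hno
      refine h1 ?_
      have h2 : ∀ᶠ z in 𝓝 z₀, z ∈ Metric.ball z₀ r ∧ φ z + Q z < φ z₀ + r ^ 2 / 8 := by
        refine Eventually.and (Metric.ball_mem_nhds z₀ hr)
          ((hcφ.tendsto z₀).eventually_lt_const ?_)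
        rw [hQ0]; linarith
      filter_upwards [hno.prod_mk h2] with w hw hlt
      exact hw.1 ⟨w.2, hw.2.1, by linarith [hw.2.2]⟩
    refine (hcen.and_eventually ((hsph.filter_mono nhdsWithin_le_nhds).and
      eventually_mem_nhdsWithin)).mono fun ε hε => ⟨fun z hz => ?_, hε.1⟩
    have := hε.2.1 z hz hε.2.2
    linarith

end IsUpperRelaxedLimit

end RelaxedLimit

/-! ### Uniqueness, and homogenization of one realization. -/

section Homogenization

variable {d : ℕ}

/-- Uniqueness for the effective Cauchy problem. -/
theorem IsCauchySolution.unique {G : Rd d → ℝ} (hG : Continuous G) {u₀ : Rd d → ℝ}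
    (hu₀ : UniformContinuous u₀) (hu₀b : ∃ C : ℝ, ∀ x, |u₀ x| ≤ C) {w w' : Rd d → ℝ → ℝ}
    (hw : IsCauchySolution (fun p _ => G p) u₀ w) (hw' : IsCauchySolution (fun p _ => G p) u₀ w')
    (x : Rd d) {t : ℝ} (ht : 0 ≤ t) : w x t = w' x t := by
  choose D hD using fun r =>
    (isCompact_closedBall (0 : Rd d) r).exists_bound_of_continuousOn hG.continuousOn
  have hu₀b' : ∃ C : ℝ, ∀ x, |(-u₀ x)| ≤ C := by simpa using hu₀b
  obtain ⟨C, hC⟩ := exists_hasInitialGrowth hu₀ hu₀b D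
  obtain ⟨C', hC'⟩ := exists_hasInitialGrowth hu₀.neg hu₀b' D
  have key : ∀ a b : Rd d → ℝ → ℝ, IsCauchySolution (fun p _ => G p) u₀ a →
      IsCauchySolution (fun p _ => G p) u₀ b → a x t ≤ b x t := fun a b ha hb => by
    have h1 := add_le_zero_of_isViscositySubOn hG hu₀ hu₀b ha.continuousOn.upperSemicontinuousOn
      hb.dual.continuousOn.upperSemicontinuousOn ha.isViscositySubOn hb.dual.isViscositySubOn
      (hC _ a (fun r p _ hp => hD r p (by simpa using hp)) ha)
      (hC' _ _ (fun r p _ hp => by simpa [dualHam] using hD r (-p) (by simpa using hp)) hb.dual)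
      x ht
    simp only at h1
    linarith
  exact le_antisymm (key w w' hw hw') (key w' w hw' hw)

/-- Homogenization for a single admissible Hamiltonian that homogenizes at a dense set of slopes. -/
theorem exists_homogenized_limit {H : Rd d → Rd d → ℝ} (hH : IsAdmissible H) {Hbar : Rd d → ℝ}
    (hbar : Continuous Hbar) {D : Set (Rd d)} (hD : Dense D)
    (hhom : ∀ p ∈ D, HomogenizesAt H p (Hbar p)) {u₀ : Rd d → ℝ}
    (hu₀ : UniformContinuous u₀) (hu₀b : ∃ C : ℝ, ∀ x, |u₀ x| ≤ C) {u : ℝ → Rd d → ℝ → ℝ}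
    (hu : ∀ ε > 0, IsCauchySolution (fun p x => H p (ε⁻¹ • x)) u₀ (u ε)) :
    ∃ ubar : Rd d → ℝ → ℝ, IsCauchySolution (fun p _ => Hbar p) u₀ ubar ∧
      TendstoLocallyUniformlyOn (fun (ε : ℝ) (z : Rd d × ℝ) => u ε z.1 z.2)
        (fun z => ubar z.1 z.2) (𝓝[>] 0) (univ ×ˢ Ioi 0) := by
  choose B hB using hH.bounded
  have hu₀b' : ∃ C : ℝ, ∀ x, |(-u₀ x)| ≤ C := by simpa using hu₀b
  obtain ⟨C, hC⟩ := exists_hasInitialGrowth hu₀ hu₀b B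
  obtain ⟨C', hC'⟩ := exists_hasInitialGrowth hu₀.neg hu₀b' B
  have hdual : ∀ ε > 0, IsCauchySolution (fun p x => dualHam H p (ε⁻¹ • x)) (fun x => - u₀ x)
      (fun x t => - u ε x t) := fun ε hε => (hu ε hε).dual
  have hg : ∀ ε > 0, HasInitialGrowth u₀ (fun z => u ε z.1 z.2) C := fun ε hε =>
    hC _ _ (fun r p x hp => hB r p hp _) (hu ε hε)
  have hg' : ∀ ε > 0, HasInitialGrowth (fun x => - u₀ x) (fun z => - u ε z.1 z.2) C' := fun ε hε =>
    hC' _ _ (fun r p x hp => by simpa [dualHam] using hB r (-p) (by simpa using hp) _) (hdual ε hε)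
  obtain ⟨M, hM⟩ := hu₀b
  have hbound : ∀ T : ℝ, ∃ K : ℝ, ∀ ε > 0, ∀ x, ∀ t ∈ Icc 0 T, |u ε x t| ≤ K := fun T => by
    refine ⟨max (M + 1 + C 1 * T) (M + 1 + C' 1 * T), fun ε hε x t ht => abs_le.2 ⟨?_, ?_⟩⟩
    · have := (hg' ε hε).le_bound (M := M) (fun x => by linarith [(abs_le.1 (hM x)).1]) T x t ht
      simp only at this
      linarith [le_max_right (M + 1 + C 1 * T) (M + 1 + C' 1 * T)]
    · exact ((hg ε hε).le_bound (M := M) (fun x => (abs_le.1 (hM x)).2) T x t ht).trans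
        (le_max_left _ _)
  obtain ⟨U, hU⟩ := exists_isUpperRelaxedLimit (u := fun ε z => u ε z.1 z.2) hbound
  obtain ⟨W, hW⟩ := exists_isUpperRelaxedLimit (u := fun ε z => - u ε z.1 z.2)
    (by simpa using hbound)
  have hUs := hU.isViscositySubOn hH hbar hD hhom (fun ε hε => (hu ε hε).continuousOn)
    (fun ε hε => (hu ε hε).isViscositySubOn)
  have hWs := hW.isViscositySubOn hH.dual (Hbar := fun p => - Hbar (-p)) (by fun_prop)
    (D := -D) (hD.preimage (Homeomorph.neg (Rd d)).isOpenMap)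
    (fun p hp => by simpa using (hhom (-p) hp).dual)
    (fun ε hε => (hdual ε hε).continuousOn) (fun ε hε => (hdual ε hε).isViscositySubOn)
  have hu₀c : Continuous u₀ := hu₀.continuous
  have hC0 : ∀ η > 0, 0 ≤ C η := fun η hη => ((hg 1 one_pos) η hη).1
  have hC0' : ∀ η > 0, 0 ≤ C' η := fun η hη => ((hg' 1 one_pos) η hη).1
  have hUg : HasInitialGrowth u₀ U C := fun η hη => ⟨hC0 η hη, fun x t ht =>
    hU.le_of_forall_le (g := fun z => u₀ z.1 + η + C η * z.2) (by fun_prop)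
      (fun ε hε x t ht => ((hg ε hε) η hη).2 x t ht) x ht⟩
  have hWg : HasInitialGrowth (fun x => - u₀ x) W C' := fun η hη => ⟨hC0' η hη, fun x t ht =>
    hW.le_of_forall_le (g := fun z => - u₀ z.1 + η + C' η * z.2) (by fun_prop)
      (fun ε hε x t ht => ((hg' ε hε) η hη).2 x t ht) x ht⟩
  -- Comparison meets the trivial inequality. From here on, upper semicontinuity of `W` is lower
  -- semicontinuity of `U`.
  have hUW : ∀ z ∈ univ ×ˢ Ici (0 : ℝ), W z = - U z := fun z hz => by
    have h1 := add_le_zero_of_isViscositySubOn hbar hu₀ ⟨M, hM⟩ hU.upperSemicontinuousOn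
      hW.upperSemicontinuousOn hUs hWs hUg hWg z.1 hz.2
    have h2 := hU.add_nonneg hW hz
    simp only [Prod.mk.eta] at h1
    linarith
  have hcont : ContinuousOn U (univ ×ˢ Ici 0) := fun z hz => by
    rw [ContinuousWithinAt, Metric.tendsto_nhds]
    intro η hη
    filter_upwards [hU.upperSemicontinuousOn z hz (U z + η) (by linarith),
      hW.upperSemicontinuousOn z hz (W z + η) (by linarith), self_mem_nhdsWithin] with w h1 h2 hw
    rw [hUW z hz, hUW w hw] at h2
    rw [Real.dist_eq, abs_lt]
    constructor <;> linarith
  refine ⟨fun x t => U (x, t), ⟨hcont, fun T => ?_, fun x => ?_, fun φ x t ht hφ hm => ?_,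
    fun φ x t ht hφ hm => ?_⟩, ?_⟩
  · refine ⟨max (M + 1 + C 1 * T) (M + 1 + C' 1 * T), fun x t ht => abs_le.2 ⟨?_, ?_⟩⟩
    · have := hWg.le_bound (M := M) (fun x => by linarith [(abs_le.1 (hM x)).1]) T x t ht
      rw [hUW (x, t) ⟨trivial, ht.1⟩] at this
      linarith [le_max_right (M + 1 + C 1 * T) (M + 1 + C' 1 * T)]
    · exact (hUg.le_bound (M := M) (fun x => (abs_le.1 (hM x)).2) T x t ht).trans
        (le_max_left _ _)
  · refine le_antisymm (le_of_forall_pos_le_add fun η hη => ?_)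
      (le_of_forall_pos_le_add fun η hη => ?_)
    · simpa using (hUg η hη).2 x 0 le_rfl
    · have := (hWg η hη).2 x 0 le_rfl
      rw [hUW (x, 0) ⟨trivial, self_mem_Ici⟩] at this
      linarith
  · exact hUs φ x t ⟨trivial, ht⟩ hφ hm
  · have hm' : IsLocalMax (fun z => W z - - φ z) (x, t) := by
      have hev : ∀ᶠ z : Rd d × ℝ in 𝓝 (x, t), 0 < z.2 :=
        (isOpen_lt continuous_const continuous_snd).mem_nhds ht
      filter_upwards [hm, hev] with z h1 hz
      rw [hUW z ⟨trivial, le_of_lt hz⟩, hUW (x, t) ⟨trivial, le_of_lt ht⟩]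
      simp only [Prod.mk.eta] at h1
      linarith
    have := hWs (fun z => - φ z) x t ⟨trivial, ht⟩ hφ.neg hm'
    rw [gradient_neg_fun, deriv.fun_neg] at this
    simp only [neg_neg] at this
    linarith
  · rw [Metric.tendstoLocallyUniformlyOn_iff]
    intro η hη z hz
    have hz0 : z ∈ univ ×ˢ Ici (0 : ℝ) := ⟨trivial, (mem_Ioi.1 hz.2).le⟩
    have hc : ∀ᶠ w : ℝ × (Rd d × ℝ) in 𝓝[>] (0 : ℝ) ×ˢ 𝓝[univ ×ˢ Ici (0 : ℝ)] z,
        dist (U w.2) (U z) < η / 2 :=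
      tendsto_snd.eventually (Metric.tendsto_nhds.1 (hcont z hz0) (η / 2) (by positivity))
    have hall : ∀ᶠ w : ℝ × (Rd d × ℝ) in 𝓝[>] (0 : ℝ) ×ˢ 𝓝[univ ×ˢ Ici (0 : ℝ)] z,
        dist (U w.2) (u w.1 w.2.1 w.2.2) < η := by
      filter_upwards [hc, hU.eventually_lt z hz0 (U z + η / 2) (by linarith),
        hW.eventually_lt z hz0 (W z + η / 2) (by linarith)] with w h1 h2 h3
      rw [hUW z hz0] at h3
      rw [Real.dist_eq, abs_lt] at h1 ⊢
      constructor <;> linarith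
    obtain ⟨p, hp, q, hq, hpq⟩ := eventually_prod_iff.1 hall
    refine ⟨{w | q w}, nhdsWithin_mono z (prod_mono subset_rfl Ioi_subset_Ici_self) hq, ?_⟩
    filter_upwards [hp] with ε hε w hw
    exact hpq hε hw

end Homogenization

/-! ### From the random Hamiltonian to almost every realization. -/

section Probability

variable {d : ℕ} {Ω : Type*} [MeasurableSpace Ω] {μ : Measure Ω} {H : Rd d → Rd d → Ω → ℝ}

theorem ae_lt_abs_of_coercive [IsProbabilityMeasure μ] (hA1 : IsStationaryErgodic μ H)
    (hA2 : IsCoerciveHamiltonian μ H) (n : ℕ) :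
    ∃ R : ℝ, ∀ p, R < ‖p‖ → ∀ x, ∀ᵐ ω ∂μ, (n : ℝ) < |H p x ω| := by
  obtain ⟨-, τ, -, -, hτ, hstat, -⟩ := hA1
  have hlt : (n : ENNReal) < liminf (fun p : Rd d =>
      essInf (fun z : Rd d × Ω => ENNReal.ofReal |H p z.1 z.2|)
        ((volume : Measure (Rd d)).prod μ)) (Bornology.cobounded (Rd d)) := by
    rw [hA2]
    exact ENNReal.natCast_lt_top n
  obtain ⟨R, -, hR⟩ := (hasBasis_cobounded_norm (E := Rd d)).eventually_iff.1
    (eventually_lt_of_lt_liminf hlt)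
  refine ⟨R, fun p hp x => ?_⟩
  -- Fubini gives the bound almost surely at some point `y`; stationarity carries it to every `x`,
  -- since `τ (x - y)` preserves null sets.
  obtain ⟨y, hy⟩ := (Measure.ae_ae_of_ae_prod (ae_lt_of_lt_essInf (hR hp.le))).exists
  have h1 := (hτ (x - y)).quasiMeasurePreserving.ae hy
  filter_upwards [h1] with ω hω
  simp only [hstat, add_sub_cancel] at hω
  rw [ENNReal.lt_ofReal_iff_toReal_lt (ENNReal.natCast_ne_top n)] at hω
  simpa using hω

theorem ae_isAdmissible [IsProbabilityMeasure μ] (hA1 : IsStationaryErgodic μ H)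
    (hA2 : IsCoerciveHamiltonian μ H) (hA3 : IsContinuousBounded H) :
    ∀ᵐ ω ∂μ, IsAdmissible fun p x => H p x ω := by
  have hunif : ∀ ω, ∀ R η : ℝ, 0 < η → ∃ s > 0, ∀ P Q : Rd d, ‖P‖ ≤ R → ‖Q‖ ≤ R → ∀ x y : Rd d,
      ‖P - Q‖ ≤ s → ‖x - y‖ ≤ s → |H P x ω - H Q y ω| ≤ η := fun ω R η hη => by
    obtain ⟨ρ, hρ, hle⟩ := hA3.1 ω _ (isCompact_closedBall (0 : Rd d) R)
    obtain ⟨b, hb, hbρ⟩ := mem_nhdsGT_iff_exists_Ioo_subset.1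
      (hρ.tendsto.eventually_lt_const hη)
    have hb : 0 < b := hb
    refine ⟨b / 3, by positivity, fun P Q hP hQ x y hPQ hxy => ?_⟩
    refine (hle P (by simpa using hP) Q (by simpa using hQ) x y).trans ?_
    rcases (add_nonneg (norm_nonneg (P - Q)) (norm_nonneg (x - y))).eq_or_lt with h | h
    · rw [← h, hρ.zero]; exact hη.le
    · exact le_of_lt (hbρ ⟨h, by linarith⟩)
  choose R hR using ae_lt_abs_of_coercive hA1 hA2
  -- Only countably many pairs are handled almost surely; the modulus of `H` extends the bound to
  -- all slopes and points. The extra `1` in the radius below covers the approximation of `P`.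
  have hae : ∀ᵐ ω ∂μ, ∀ n i j : ℕ, R n < ‖TopologicalSpace.denseSeq (Rd d) i‖ →
      (n : ℝ) < |H (TopologicalSpace.denseSeq (Rd d) i) (TopologicalSpace.denseSeq (Rd d) j) ω| := by
    simp only [ae_all_iff]
    intro n i j hi
    exact hR n _ hi _
  filter_upwards [hae] with ω hω
  refine ⟨hunif ω, fun r => ?_, fun M => ?_⟩
  · obtain ⟨C, hC⟩ := hA3.2 _ (isCompact_closedBall (0 : Rd d) r)
    exact ⟨C, fun P hP x => hC P (by simpa using hP) x ω⟩
  · obtain ⟨n, hn⟩ := exists_nat_gt M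
    refine ⟨R n + 1, fun P hP x => hn.trans_le ?_⟩
    refine le_of_forall_pos_le_add fun η hη => ?_
    obtain ⟨s, hs, hsH⟩ := hunif ω (‖P‖ + 1) η hη
    obtain ⟨i, hi⟩ := (TopologicalSpace.denseRange_denseSeq (Rd d)).exists_dist_lt P
      (by positivity : 0 < min s 1)
    obtain ⟨j, hj⟩ := (TopologicalSpace.denseRange_denseSeq (Rd d)).exists_dist_lt x hs
    rw [dist_eq_norm] at hi hj
    set q := TopologicalSpace.denseSeq (Rd d) i
    set y := TopologicalSpace.denseSeq (Rd d) j
    have h1 : ‖P‖ - ‖q‖ < 1 :=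
      (norm_sub_norm_le P q).trans_lt (hi.trans_le (min_le_right _ _))
    have h2 : ‖q‖ - ‖P‖ < 1 := (norm_sub_norm_le q P).trans_lt
      (by rw [norm_sub_rev]; exact hi.trans_le (min_le_right _ _))
    have h3 := hω n i j (by linarith)
    have h4 := hsH P q (by linarith) (by linarith) x y (hi.le.trans (min_le_left _ _)) hj.le
    have h5 := abs_sub_abs_le_abs_sub (H q y ω) (H P x ω)
    rw [abs_sub_comm] at h5
    linarith

/-- Sequential continuity is what null sets allow: along a sequence, one `ω` homogenizes at all its
terms and at the limit, and the deterministic estimate applies to that `ω`. -/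
theorem continuous_effective [IsProbabilityMeasure μ]
    (hadm : ∀ᵐ ω ∂μ, IsAdmissible fun p x => H p x ω) {Hbar : Rd d → ℝ}
    (hreg : ∀ p, IsRegularlyHomogenizableAt μ H p (Hbar p)) : Continuous Hbar := by
  rw [continuous_iff_continuousAt]
  intro p
  refine tendsto_of_seq_tendsto fun q hq => ?_
  have hp : ∀ᵐ ω ∂μ, HomogenizesAt (fun p x => H p x ω) p (Hbar p) := hreg p
  have hqn : ∀ᵐ ω ∂μ, ∀ n, HomogenizesAt (fun p x => H p x ω) (q n) (Hbar (q n)) :=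
    ae_all_iff.2 fun n => hreg (q n)
  obtain ⟨ω, hω, hωp, hωq⟩ := (hadm.and (hp.and hqn)).exists
  rw [Metric.tendsto_nhds]
  intro η hη
  obtain ⟨κ, hκ, key⟩ := hωp.exists_abs_sub_le hω (half_pos hη)
  filter_upwards [Metric.tendsto_nhds.1 hq κ hκ] with n hn
  rw [dist_eq_norm] at hn
  have := key (q n) _ (hωq n) hn.le
  rw [Function.comp, Real.dist_eq]
  linarith

end Probability

theorem mainTheorem5 {d : ℕ} {Ω : Type*} [MeasurableSpace Ω] (μ : Measure Ω)
    [IsProbabilityMeasure μ]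
    (H : Rd d → Rd d → Ω → ℝ)
    (hA1 : IsStationaryErgodic μ H) (hA2 : IsCoerciveHamiltonian μ H) (hA3 : IsContinuousBounded H)
    (Hbar : Rd d → ℝ) (hreg : ∀ p, IsRegularlyHomogenizableAt μ H p (Hbar p))
    (u₀ : Rd d → ℝ) (hu₀ : UniformContinuous u₀) (hu₀b : ∃ C : ℝ, ∀ x, |u₀ x| ≤ C)
    (u : ℝ → Ω → Rd d → ℝ → ℝ)
    (hu : ∀ᵐ ω ∂μ, ∀ ε > 0, IsCauchySolution (fun p x => H p (ε⁻¹ • x) ω) u₀ (u ε ω)) :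
    ∃ (Ω' : Set Ω) (ubar : Rd d → ℝ → ℝ),
      MeasurableSet Ω' ∧ μ Ω' = 1 ∧
      (∀ ω ∈ Ω', TendstoLocallyUniformlyOn
        (fun (ε : ℝ) (z : Rd d × ℝ) => u ε ω z.1 z.2) (fun z => ubar z.1 z.2)
        (𝓝[>] 0) (univ ×ˢ Ioi 0)) ∧
      IsCauchySolution (fun p _ => Hbar p) u₀ ubar ∧
      (∀ w : Rd d → ℝ → ℝ, IsCauchySolution (fun p _ => Hbar p) u₀ w →
        ∀ x, ∀ t ≥ 0, w x t = ubar x t) := by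
  have hadm := ae_isAdmissible hA1 hA2 hA3
  have hbar := continuous_effective hadm hreg
  have hhom : ∀ᵐ ω ∂μ, ∀ n : ℕ, HomogenizesAt (fun p x => H p x ω)
      (TopologicalSpace.denseSeq (Rd d) n) (Hbar (TopologicalSpace.denseSeq (Rd d) n)) :=
    ae_all_iff.2 fun n => hreg _
  have hlim : ∀ᵐ ω ∂μ, ∃ ubar : Rd d → ℝ → ℝ, IsCauchySolution (fun p _ => Hbar p) u₀ ubar ∧
      TendstoLocallyUniformlyOn (fun (ε : ℝ) (z : Rd d × ℝ) => u ε ω z.1 z.2)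
        (fun z => ubar z.1 z.2) (𝓝[>] 0) (univ ×ˢ Ioi 0) := by
    filter_upwards [hadm, hhom, hu] with ω h1 h2 h3
    exact exists_homogenized_limit h1 hbar (TopologicalSpace.denseRange_denseSeq (Rd d))
      (by rintro _ ⟨n, rfl⟩; exact h2 n) hu₀ hu₀b h3
  obtain ⟨Ω', hΩ', hmeas, hΩ'lim⟩ := hlim.exists_measurable_mem
  -- The limit of a single realization serves for all, because the effective problem is
  -- deterministic and has a unique solution.
  obtain ⟨ω₀, ubar, hsol, -⟩ := hlim.exists
  refine ⟨Ω', ubar, hmeas, mem_ae_iff_prob_eq_one hmeas |>.1 hΩ', fun ω hω => ?_, hsol,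
    fun w hw x t ht => hw.unique hbar hu₀ hu₀b hsol x ht⟩
  obtain ⟨w, hw, hwlim⟩ := hΩ'lim ω hω
  exact hwlim.congr_right fun z hz => hw.unique hbar hu₀ hu₀b hsol z.1 (mem_Ioi.1 hz.2).le
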